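/- Setting. Let $(\mathbb X,\mathcal X)$ be a measurable space whose diagonal $\{(x,x)\}$ is measurable in the product $\mathbb X\times\mathbb X$, and $(\mathbb Y,\mathcal Y)$ a measurable space. Consider a hidden Markov model with signal $X_0\sim\pi_0$, $X_n\mid X_{n-1}=x\sim K(x,\cdot)$ ($\pi_0$ a probability measure, $K$ a Markov kernel), and observations $Y_n\mid X_n=x\sim G(x,\cdot)$, where $G(x,\cdot)$ has a density $g(x,\cdot)$ with respect to a $\sigma$-finite measure, $g\ge 0$ jointly measurable. Fix observations $(y_n)_{n\ge0}$, put $g_n=g(\cdot,y_n)$, and suppose $g_n>0$ for all $n\ge0$. The exact filter is the conditional law of $X_n$ given $Y_0=y_0,\dots,Y_n=y_n$, that is, $$\widehat\pi_n(\varphi)=\frac{\mathbb E\big[\varphi(X_n)\prod_{k=0}^n g_k(X_k)\big]}{\mathbb E\big[\prod_{k=0}^n g_k(X_k)\big]}.$$ Let $L\ge0$ and, for all $n\ge 0$, let $g_n^0,\dots,g_n^L:\mathbb X\to\mathbb R$ be bounded measurable functions with $g_n^L=g_n$; put $g_n^{-1}=0$ and $\Delta g_n^\ell=g_n^\ell-g_n^{\ell-1}$.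 Suppose that either $\pi_0(\{z\})=0$ and $K(x,\{z\})=0$ for all $x,z\in\mathbb X$, or $\Delta g_n^\ell\ge0$ for all $n$ and $0\le\ell\le L$ (for example $L=0$). Algorithm (multilevel bootstrap particle filter). Let $c_0,\dots,c_L$ be positive integers. For $N\ge1$ put $N_\ell=c_\ell N$ and $S(N)=\sum_{\ell=0}^L N_\ell$, and partition $\{1,\dots,S(N)\}$ into sets $P^N_0,\dots,P^N_L$ with $|P^N_\ell|=N_\ell$. Start with $\xi_0^1,\dots,\xi_0^{S(N)}$ i.i.d. from $\pi_0$ and $w_0^i=1$. For $n=0,1,2,\dots$: 1. $\widetilde w_n^i=N_\ell^{-1}\,\Delta g_n^\ell(\xi_n^i)\,w_n^i$ for $i\in P_\ell^N$, $0\le\ell\le L$; 2. given the past, draw $\widehat\xi_n^1,\dots,\widehat\xi_n^{S(N)}$ independently from the normalised total variation measure $\sum_{j}|\widetilde w_n^j|\delta_{\xi_n^j}\big/\sum_{j}|\widetilde w_n^j|$ (in an arbitrary way if all $\widetilde w_n^j$ vanish), and put $\widehat w_n^i=\mathrm{sgn}\big(\sum_{j}\widetilde w_n^j\,\mathbb I[\widehat\xi_n^i=\xi_n^j]\big)$;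 3. given the past, draw $\xi_{n+1}^i\sim K(\widehat\xi_n^i,\cdot)$ independently over $i$, and put $w_{n+1}^i=\widehat w_n^i$. Suppose that for every $N\ge1$ such a particle system is given, all of them on one probability space, with arbitrary dependence between different $N$. Put $$\widehat\pi_n^N(\varphi)=\frac{\sum_{i=1}^{S(N)}\widehat w_n^i\,\varphi(\widehat\xi_n^i)}{\sum_{i=1}^{S(N)}\widehat w_n^i}.$$ Theorem. For every bounded measurable $\varphi:\mathbb X\to\mathbb R$ and every $n\ge0$, $\widehat\pi_n^N(\varphi)\to\widehat\pi_n(\varphi)$ almost surely as $N\to\infty$. -/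

import Mathlib

open MeasureTheory ProbabilityTheory Filter
open scoped ENNReal Topology

noncomputable section

namespace MLBPF

/-- A hidden Markov model with signal space `X` and observation space `Y`: the signal has initial
law `init` and Markov transition kernel `K`, the observation given the signal has law `G x`, and
`g x` is a density of `G x` with respect to a `σ`-finite measure `ν`. -/
structure HiddenMarkovModel (X Y : Type*) [MeasurableSpace X] [MeasurableSpace Y] where
  init : Measure X
  K : Kernel X X
  G : Kernel X Y
  ν : Measure Y
  g : X → Y → ℝ
  init_prob : IsProbabilityMeasure init
  K_markov : IsMarkovKernel K
  G_markov : IsMarkovKernel G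
  ν_sigmaFinite : SigmaFinite ν
  g_measurable : Measurable (Function.uncurry g)
  g_nonneg : ∀ x y, 0 ≤ g x y
  g_density : ∀ x, G x = ν.withDensity (fun y => ENNReal.ofReal (g x y))

variable {X Y Ω : Type*} [MeasurableSpace X] [MeasurableSpace Y] [MeasurableSpace Ω]

/-- The law of the signal path `(X_0, …, X_n)`. -/
def HiddenMarkovModel.signalLaw (M : HiddenMarkovModel X Y) : (n : ℕ) → Measure (Fin (n + 1) → X)
  | 0 => M.init.map (fun x _ => x)
  | n + 1 =>
      (M.signalLaw n ⊗ₘ M.K.comap (fun x => x (Fin.last n)) (measurable_pi_apply _)).map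
        (fun p => (Fin.snoc p.1 p.2 : Fin (n + 2) → X))

/-- The likelihood `∏_{k ≤ n} g(x_k, y_k)` of the observations `y_0, …, y_n` given the signal path
`(x_0, …, x_n)`. -/
def HiddenMarkovModel.likelihood (M : HiddenMarkovModel X Y) (y : ℕ → Y) (n : ℕ)
    (x : Fin (n + 1) → X) : ℝ≥0∞ :=
  ∏ k : Fin (n + 1), ENNReal.ofReal (M.g (x k) (y k))

/-- The exact filter, that is, the conditional law of `X_n` given `Y_0 = y_0, …, Y_n = y_n`
(Bayes' formula with the conditional density of the observations). -/
def HiddenMarkovModel.filter (M : HiddenMarkovModel X Y) (y : ℕ → Y) (n : ℕ) : Measure X :=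
  (∫⁻ x, M.likelihood y n x ∂(M.signalLaw n))⁻¹ •
    ((M.signalLaw n).withDensity (M.likelihood y n)).map (fun x => x (Fin.last n))

/-- The telescoping differences `Δg^ℓ = g^ℓ - g^(ℓ-1)`, with `g^(-1) = 0`. -/
def levelDiff {L : ℕ} (g : Fin (L + 1) → X → ℝ) (l : Fin (L + 1)) (x : X) : ℝ :=
  g l x - Fin.cases (motive := fun _ => ℝ) 0 (fun k : Fin L => g k.castSucc x) l

/-- The particle indices: `(ℓ, k)` is the `k`-th of the `N_ℓ = c_ℓ N` particles of level `ℓ`. -/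
abbrev Particle {L : ℕ} (c : Fin (L + 1) → ℕ) (N : ℕ) : Type :=
  (l : Fin (L + 1)) × Fin (c l * N)

section Algorithm

variable {L : ℕ} (g : ℕ → Fin (L + 1) → X → ℝ) (c : Fin (L + 1) → ℕ) (N : ℕ)

/-- The weights `w̃_n^i = N_ℓ⁻¹ Δg_n^ℓ(ξ_n^i) w_n^i`, for `i` of level `ℓ`, of particles at `x` that
have the weights `w`. -/
def updatedWeight (n : ℕ) (x : Particle c N → X) (w : Particle c N → ℝ) (i : Particle c N) : ℝ :=
  ((c i.1 * N : ℕ) : ℝ)⁻¹ * levelDiff (g n) i.1 (x i) * w i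

open Classical in
/-- The sign `sgn (∑_j w̃^j 𝟙[z = ξ^j])` given to a particle that is resampled to the place `z`. -/
def resampledSign (x : Particle c N → X) (wt : Particle c N → ℝ) (z : X) : ℝ :=
  Real.sign (∑ j, if z = x j then wt j else 0)

/-- The weights `w_n^i` as a function of the particles `x q i = ξ_q^i` and `xh q i = ξ̂_q^i`:
`w_0^i = 1` and `w_{n+1}^i = ŵ_n^i`. -/
def weight (x xh : ℕ → Particle c N → X) : ℕ → Particle c N → ℝ
  | 0 => fun _ => 1
  | n + 1 => fun i =>
      resampledSign c N (x n) (updatedWeight g c N n (x n) (weight x xh n)) (xh n i)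

/-- The weights `w̃_n^i` as a function of the particles. -/
def weightTilde (x xh : ℕ → Particle c N → X) (n : ℕ) : Particle c N → ℝ :=
  updatedWeight g c N n (x n) (weight g c N x xh n)

/-- The weights `ŵ_n^i` as a function of the particles. -/
def weightHat (x xh : ℕ → Particle c N → X) (n : ℕ) (i : Particle c N) : ℝ :=
  resampledSign c N (x n) (weightTilde g c N x xh n) (xh n i)

/-- The total variation measure `∑_i |w̃^i| δ_{ξ^i}`. -/
def tvMeasure (x : Particle c N → X) (wt : Particle c N → ℝ) : Measure X :=
  ∑ i, ENNReal.ofReal |wt i| • Measure.dirac (x i)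

/-- The normalised total variation measure, from which the particles are resampled. -/
def resamplingLaw (x : Particle c N → X) (wt : Particle c N → ℝ) : Measure X :=
  (tvMeasure c N x wt Set.univ)⁻¹ • tvMeasure c N x wt

/-- The integral of `φ` with respect to the filter approximation
`(∑_i ŵ_n^i δ_{ξ̂_n^i}) / (∑_i ŵ_n^i)`. -/
def filterApprox (x xh : ℕ → Particle c N → X) (n : ℕ) (φ : X → ℝ) : ℝ :=
  (∑ i, weightHat g c N x xh n i * φ (xh n i)) / ∑ i, weightHat g c N x xh n i

end Algorithm

/-- The `σ`-algebra generated by `ξ_q^i`, `q ≤ n`, and `ξ̂_p^i`, `p < n`. -/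
abbrev historyBeforeResampling {ι : Type*} (ξ ξh : ℕ → ι → Ω → X) (n : ℕ) : MeasurableSpace Ω :=
  (⨆ q ≤ n, ⨆ i, MeasurableSpace.comap (ξ q i) inferInstance) ⊔
    ⨆ p < n, ⨆ i, MeasurableSpace.comap (ξh p i) inferInstance

/-- The `σ`-algebra generated by `ξ_q^i`, `q ≤ n`, and `ξ̂_p^i`, `p ≤ n`. -/
abbrev historyAfterResampling {ι : Type*} (ξ ξh : ℕ → ι → Ω → X) (n : ℕ) : MeasurableSpace Ω :=
  (⨆ q ≤ n, ⨆ i, MeasurableSpace.comap (ξ q i) inferInstance) ⊔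
    ⨆ p ≤ n, ⨆ i, MeasurableSpace.comap (ξh p i) inferInstance

/-- On the event `E`, the random variables `Z i` are conditionally independent given the
`σ`-algebra `m`, and `Z i` has the conditional law `μ i`. -/
def CondIndepLawsOn {ι : Type*} [Fintype ι] (P : Measure Ω) (m : MeasurableSpace Ω) (E : Set Ω)
    (Z : ι → Ω → X) (μ : ι → Ω → Measure X) : Prop :=
  ∀ s : Set Ω, MeasurableSet[m] s → s ⊆ E → ∀ A : ι → Set X, (∀ i, MeasurableSet (A i)) →
    P (s ∩ ⋂ i, Z i ⁻¹' A i) = ∫⁻ ω in s, ∏ i, μ i ω (A i) ∂P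

/-- `ξ n i = ξ_n^i` and `ξh n i = ξ̂_n^i` are the particles of a run of the multilevel bootstrap
particle filter with sample size parameter `N`, on the probability space `(Ω, P)`. Where all the
weights `w̃_n^i` vanish, the law to resample from is undefined and no condition is put on the
resampled particles. -/
structure IsRun {L : ℕ} (M : HiddenMarkovModel X Y) (g : ℕ → Fin (L + 1) → X → ℝ)
    (c : Fin (L + 1) → ℕ) (N : ℕ) (P : Measure Ω) (ξ ξh : ℕ → Particle c N → Ω → X) : Prop where
  measurable_particle : ∀ n i, Measurable (ξ n i)
  measurable_resampled : ∀ n i, Measurable (ξh n i)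
  init_indep : iIndepFun (ξ 0) P
  init_law : ∀ i, P.map (ξ 0 i) = M.init
  resample : ∀ n, CondIndepLawsOn P (historyBeforeResampling ξ ξh n)
    {ω | ∃ i, weightTilde g c N (fun q j => ξ q j ω) (fun q j => ξh q j ω) n i ≠ 0}
    (ξh n)
    (fun _ ω => resamplingLaw c N (fun j => ξ n j ω)
      (weightTilde g c N (fun q j => ξ q j ω) (fun q j => ξh q j ω) n))
  mutate : ∀ n, CondIndepLawsOn P (historyAfterResampling ξ ξh n) Set.univ (ξ (n + 1))
    (fun i ω => M.K (ξh n i ω))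

end MLBPF

end

/-! ### Hoeffding bounds, unconditional and conditional. -/

noncomputable section

namespace MLBPF

variable {X Y Ω T ι : Type*} [MeasurableSpace X] [MeasurableSpace Y] [MeasurableSpace Ω]
  [MeasurableSpace T]

/-! The exact filter obeys a recursion: multiply by the likelihood, then apply K (`prediction`,
`unnormalizedFilter`). The invariant carried along it is `ApproximatesOnLevels`: on each level
separately, the average of w ψ(ξ) differs from r_N ∫ψ by a term that tends to zero almost surely.
The random factor r_N is the same for all levels and test functions, and is eventually bounded away
from zero. Levels must be kept apart because the next reweighting uses a different Δg^ℓ on each; the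
common factor lets the differences telescope to the exact likelihood.

No limit of r_N is required. Resampling divides it by ∑|w̃|, which signed averages do not determine,
but which has two bounds: it is at most (L+1)D, where D bounds all |Δg^ℓ|, since weights have
modulus at most one; and it is at least ∑w̃, which is asymptotic to r_N times the positive mass of
the unnormalised filter. In the final ratio r_N cancels (`ApproximatesOnLevels.ae_tendsto_ratio`).

Given the past, the particles of each random step are independent, so a conditional Hoeffding
inequality bounds deviations of level averages exponentially in N. Borel–Cantelli then gives almost
sure convergence (`ae_tendsto_levelMean`), whatever the dependence between different N. The
conditional mean at resampling is the signed measure divided by its total variation, provided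
coinciding particles never have weights of opposite signs (`abs_mul_resampledSign`). This holds
almost surely when the signal laws charge no points, and trivially when no weight is negative. -/

/-- Two-sided Hoeffding inequality for independent random variables bounded by `C`. -/
lemma measure_abs_sum_sub_integral_ge_le {P : Measure Ω} [IsProbabilityMeasure P]
    {Z : ι → Ω → ℝ} (hZ : ∀ i, Measurable (Z i)) (hind : iIndepFun Z P) {C : ℝ}
    (hC : ∀ i ω, |Z i ω| ≤ C) (F : Finset ι) {ε : ℝ} (hε : 0 ≤ ε) :
    P {ω | ε * F.card ≤ |∑ i ∈ F, (Z i ω - P[Z i])|} ≤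
      ENNReal.ofReal (2 * Real.exp (-(ε ^ 2 / (2 * C ^ 2)) * F.card)) := by
  have hsub : ∀ i, HasSubgaussianMGF (fun ω => Z i ω - P[Z i]) ((‖C - -C‖₊ / 2) ^ 2) P :=
    fun i => hasSubgaussianMGF_of_mem_Icc (hZ i).aemeasurable
      (ae_of_all _ fun ω => abs_le.1 (hC i ω))
  have hind1 : iIndepFun (fun i ω => Z i ω - P[Z i]) P :=
    hind.comp (fun i (x : ℝ) => x - ∫ ω, Z i ω ∂P) (fun i => by fun_prop)
  have hind2 : iIndepFun (fun i => -(fun ω => Z i ω - P[Z i])) P :=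
    hind.comp (fun i (x : ℝ) => -(x - ∫ ω, Z i ω ∂P)) (fun i => by fun_prop)
  have hcard : (0 : ℝ) ≤ ε * F.card := by positivity
  have h1 := HasSubgaussianMGF.measure_sum_ge_le_of_iIndepFun hind1 (s := F)
    (fun i _ => hsub i) hcard
  have h2 := HasSubgaussianMGF.measure_sum_ge_le_of_iIndepFun hind2 (s := F)
    (fun i _ => (hsub i).neg) hcard
  -- The range [-C, C] gives the variance proxy (2C/2)² = C² per variable. For empty `F` or C = 0
  -- both exponents are zero, by the convention for division by zero.
  have hexp : -(ε * F.card) ^ 2 / (2 * ((∑ _i ∈ F, (‖C - -C‖₊ / 2) ^ 2 : NNReal) : ℝ)) =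
      -(ε ^ 2 / (2 * C ^ 2)) * F.card := by
    have hc : ((∑ _i ∈ F, (‖C - -C‖₊ / 2) ^ 2 : NNReal) : ℝ) = F.card * C ^ 2 := by
      push_cast
      rw [Finset.sum_const, nsmul_eq_mul, div_pow, Real.norm_eq_abs, sq_abs]
      ring
    rw [hc]
    rcases eq_or_ne (F.card : ℝ) 0 with h | h
    · simp [h]
    rcases eq_or_ne C 0 with h' | h'
    · simp [h']
    field_simp
  rw [hexp] at h1 h2
  refine (measure_mono (t := {ω | ε * F.card ≤ ∑ i ∈ F, (Z i ω - P[Z i])} ∪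
    {ω | ε * F.card ≤ ∑ i ∈ F, (-(fun ω => Z i ω - P[Z i])) ω}) ?_).trans
      ((measure_union_le _ _).trans ?_)
  · intro ω hω
    rcases le_abs.1 (Set.mem_ofPred_eq ▸ hω) with h | h
    · exact Or.inl h
    · refine Or.inr ?_
      simp only [Set.mem_ofPred_eq, Pi.neg_apply, Finset.sum_neg_distrib]
      exact h
  · rw [two_mul, ENNReal.ofReal_add (by positivity) (by positivity)]
    refine add_le_add ?_ ?_
    · rw [← ofReal_measureReal]
      exact ENNReal.ofReal_le_ofReal h1
    · rw [← ofReal_measureReal]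
      exact ENNReal.ofReal_le_ofReal h2

variable [Fintype ι]

/-- The kernel `t ↦ ⨂ i, κ i t`. -/
def piKernel (κ : ι → Kernel T X) [∀ i, IsFiniteKernel (κ i)] : Kernel T (ι → X) where
  toFun t := Measure.pi fun i => κ i t
  measurable' := by
    have hp : ∀ A : ι → Set X, (∀ i, MeasurableSet (A i)) →
        Measurable fun t => (Measure.pi fun i => κ i t) (Set.univ.pi A) := fun A hA => by
      simp only [Measure.pi_pi]
      exact Finset.measurable_prod _ fun i _ => (κ i).measurable_coe (hA i)
    refine Measurable.measure_of_isPiSystem generateFrom_pi.symm isPiSystem_pi ?_ ?_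
    · rintro _ ⟨A, hA, rfl⟩
      exact hp A fun i => hA i (Set.mem_univ i)
    · simpa using hp (fun _ => Set.univ) fun _ => MeasurableSet.univ

instance (κ : ι → Kernel T X) [∀ i, IsFiniteKernel (κ i)] : IsFiniteKernel (piKernel κ) := by
  refine ⟨⟨∏ i, (κ i).bound, ENNReal.prod_lt_top fun i _ => (κ i).bound_lt_top, fun t => ?_⟩⟩
  change (Measure.pi fun i => κ i t) Set.univ ≤ _
  rw [Measure.pi_univ]
  exact Finset.prod_le_prod' fun i _ => (κ i).measure_le_bound t _

/-- If the `Z i` are conditionally independent given `H` with laws `κ i H`, on an event that `H`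
determines, then the joint law of `H` and `Z` on that event is a composition product. -/
lemma map_restrict_eq_compProd_piKernel {P : Measure Ω} [IsProbabilityMeasure P] {H : Ω → T}
    (hH : Measurable H) {E : Set T} (hE : MeasurableSet E)
    (κ : ι → Kernel T X) [∀ i, IsFiniteKernel (κ i)] {Z : ι → Ω → X} (hZ : ∀ i, Measurable (Z i))
    (hcond : ∀ s, MeasurableSet s → s ⊆ E → ∀ A : ι → Set X, (∀ i, MeasurableSet (A i)) →
      P (H ⁻¹' s ∩ ⋂ i, Z i ⁻¹' A i) = ∫⁻ ω in H ⁻¹' s, ∏ i, κ i (H ω) (A i) ∂P) :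
    (P.restrict (H ⁻¹' E)).map (fun ω => (H ω, fun i => Z i ω)) =
      ((P.restrict (H ⁻¹' E)).map H) ⊗ₘ piKernel κ := by
  have hHZ : Measurable fun ω => (H ω, fun i => Z i ω) := hH.prodMk (measurable_pi_lambda _ hZ)
  have key : ∀ s, MeasurableSet s → ∀ A : ι → Set X, (∀ i, MeasurableSet (A i)) →
      (P.restrict (H ⁻¹' E)).map (fun ω => (H ω, fun i => Z i ω)) (s ×ˢ Set.univ.pi A) =
      (((P.restrict (H ⁻¹' E)).map H) ⊗ₘ piKernel κ) (s ×ˢ Set.univ.pi A) := by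
    intro s hs A hA
    have hpi : MeasurableSet (Set.univ.pi A) := MeasurableSet.univ_pi hA
    rw [Measure.compProd_apply_prod hs hpi, Measure.map_apply hHZ (hs.prod hpi),
      Measure.restrict_apply (hHZ (hs.prod hpi)), Measure.restrict_map hH hs,
      lintegral_map ((piKernel κ).measurable_coe hpi) hH,
      Measure.restrict_restrict (hH hs), ← Set.preimage_inter]
    -- The hypothesis covers only events inside `E`; intersecting with `E` matches the restriction
    -- of `P`.
    have h := hcond (s ∩ E) (hs.inter hE) Set.inter_subset_right A hA
    have h1 : ∀ ω, piKernel κ (H ω) (Set.univ.pi A) = ∏ i, κ i (H ω) (A i) := fun ω =>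
      Measure.pi_pi _ _
    simp only [h1]
    rw [← h]
    congr 1
    ext ω
    simp only [Set.mem_inter_iff, Set.mem_preimage, Set.mem_prod, Set.mem_univ_pi, Set.mem_iInter]
    tauto
  have hgen : (inferInstance : MeasurableSpace (T × (ι → X))) =
      MeasurableSpace.generateFrom (Set.image2 (· ×ˢ ·) {s : Set T | MeasurableSet s}
        (Set.univ.pi '' Set.univ.pi fun _ => {s : Set X | MeasurableSet s})) := by
    refine (generateFrom_eq_prod MeasurableSpace.generateFrom_measurableSet generateFrom_pi
      isCountablySpanning_measurableSet ?_).symm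
    exact ⟨fun _ => Set.univ, fun _ => ⟨fun _ => Set.univ, by simp, by simp⟩,
      Set.iUnion_const _⟩
  refine ext_of_generate_finite _ hgen
    (MeasurableSpace.isPiSystem_measurableSet.prod isPiSystem_pi) ?_ ?_
  · rintro _ ⟨s, hs, _, ⟨A, hA, rfl⟩, rfl⟩
    exact key s hs A fun i => hA i (Set.mem_univ i)
  · simpa using key Set.univ MeasurableSet.univ (fun _ => Set.univ) fun _ => MeasurableSet.univ

/-- Conditional Hoeffding inequality. -/
lemma measure_abs_sum_sub_ge_le_of_cond {P : Measure Ω} [IsProbabilityMeasure P] {H : Ω → T}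
    (hH : Measurable H) {E : Set T} (hE : MeasurableSet E)
    (κ : ι → Kernel T X) [∀ i, IsFiniteKernel (κ i)]
    (hκ : ∀ i, ∀ t ∈ E, IsProbabilityMeasure (κ i t)) {Z : ι → Ω → X} (hZ : ∀ i, Measurable (Z i))
    (hcond : ∀ s, MeasurableSet s → s ⊆ E → ∀ A : ι → Set X, (∀ i, MeasurableSet (A i)) →
      P (H ⁻¹' s ∩ ⋂ i, Z i ⁻¹' A i) = ∫⁻ ω in H ⁻¹' s, ∏ i, κ i (H ω) (A i) ∂P)
    {f : ι → T → X → ℝ} (hf : ∀ i, Measurable (Function.uncurry (f i))) {C : ℝ}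
    (hC : ∀ i t x, |f i t x| ≤ C) {b : ι → T → ℝ} (hb : ∀ i, Measurable (b i))
    (hfb : ∀ i, ∀ t ∈ E, ∫ x, f i t x ∂κ i t = b i t) (F : Finset ι) {ε : ℝ} (hε : 0 ≤ ε) :
    P {ω | H ω ∈ E ∧ ε * F.card ≤ |∑ i ∈ F, (f i (H ω) (Z i ω) - b i (H ω))|} ≤
      ENNReal.ofReal (2 * Real.exp (-(ε ^ 2 / (2 * C ^ 2)) * F.card)) := by
  have hHZ : Measurable fun ω => (H ω, fun i => Z i ω) := hH.prodMk (measurable_pi_lambda _ hZ)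
  set S : Set (T × (ι → X)) :=
    {p | ε * F.card ≤ |∑ i ∈ F, (f i p.1 (p.2 i) - b i p.1)|} with hS
  have hSm : MeasurableSet S := by
    refine measurableSet_le measurable_const ?_
    have hm : ∀ i, Measurable fun p : T × (ι → X) => f i p.1 (p.2 i) - b i p.1 := fun i =>
      ((hf i).comp (measurable_fst.prodMk ((measurable_pi_apply i).comp measurable_snd))).sub
        ((hb i).comp measurable_fst)
    exact (Finset.measurable_sum _ fun i _ => hm i).norm
  have h1 : P {ω | H ω ∈ E ∧ ε * F.card ≤ |∑ i ∈ F, (f i (H ω) (Z i ω) - b i (H ω))|} =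
      (((P.restrict (H ⁻¹' E)).map H) ⊗ₘ piKernel κ) S := by
    rw [← map_restrict_eq_compProd_piKernel hH hE κ hZ hcond, Measure.map_apply hHZ hSm,
      Measure.restrict_apply (hHZ hSm), Set.inter_comm]
    rfl
  rw [h1, Measure.compProd_apply hSm, lintegral_map (Kernel.measurable_kernel_prodMk_left hSm) hH]
  have h2 : ∀ ω ∈ H ⁻¹' E, piKernel κ (H ω) (Prod.mk (H ω) ⁻¹' S) ≤
      ENNReal.ofReal (2 * Real.exp (-(ε ^ 2 / (2 * C ^ 2)) * F.card)) := by
    intro ω hω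
    have := fun i => hκ i (H ω) hω
    have hfm : ∀ i, Measurable (f i (H ω)) := fun i => (hf i).comp measurable_prodMk_left
    have h3 := measure_abs_sum_sub_integral_ge_le
      (P := Measure.pi fun i => κ i (H ω)) (Z := fun i z => f i (H ω) (z i))
      (fun i => (hfm i).comp (measurable_pi_apply i))
      (iIndepFun_pi fun i => (hfm i).aemeasurable) (fun i z => hC i _ _) F hε
    refine le_trans (le_of_eq ?_) h3
    change (Measure.pi fun i => κ i (H ω)) _ = _
    congr 1
    ext z
    have h4 : ∀ i, ∫ z, f i (H ω) (z i) ∂(Measure.pi fun i => κ i (H ω)) = b i (H ω) := by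
      intro i
      rw [← hfb i _ hω]
      exact integral_comp_eval (hfm i).aestronglyMeasurable
    simp only [hS, Set.mem_preimage, Set.mem_ofPred_eq, h4]
  -- The bound is uniform over the conditioning event, whose mass is at most one.
  refine (setLIntegral_mono measurable_const h2).trans ?_
  rw [setLIntegral_const]
  exact mul_le_of_le_one_right' prob_le_one

/-- Conditional Hoeffding inequality given a `σ`-algebra. -/
lemma CondIndepLawsOn.measure_abs_sum_sub_ge_le {Ω : Type*} {m mΩ : MeasurableSpace Ω}
    {P : Measure Ω} [IsProbabilityMeasure P] (hm : m ≤ mΩ) {E : Set Ω} (hE : MeasurableSet[m] E)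
    {Z : ι → Ω → X} (hZ : ∀ i, Measurable (Z i))
    (κ : ι → Kernel[m] Ω X) [∀ i, IsFiniteKernel (κ i)]
    (hκ : ∀ i, ∀ ω ∈ E, IsProbabilityMeasure (κ i ω))
    (hcond : CondIndepLawsOn P m E Z fun i ω => κ i ω)
    {f : ι → Ω → X → ℝ} (hf : ∀ i, Measurable[m.prod inferInstance] (Function.uncurry (f i)))
    {C : ℝ} (hC : ∀ i ω x, |f i ω x| ≤ C) {b : ι → Ω → ℝ} (hb : ∀ i, Measurable[m] (b i))
    (hfb : ∀ i, ∀ ω ∈ E, ∫ x, f i ω x ∂κ i ω = b i ω) (F : Finset ι) {ε : ℝ} (hε : 0 ≤ ε) :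
    P {ω | ω ∈ E ∧ ε * F.card ≤ |∑ i ∈ F, (f i ω (Z i ω) - b i ω)|} ≤
      ENNReal.ofReal (2 * Real.exp (-(ε ^ 2 / (2 * C ^ 2)) * F.card)) :=
  -- Here `H` is the identity from (Ω, mΩ) to (Ω, m), measurable because `m ≤ mΩ`. Explicit
  -- arguments keep the two σ-algebras apart.
  @measure_abs_sum_sub_ge_le_of_cond X Ω Ω ι _ mΩ m _ P _ id (measurable_id'' hm) E hE κ _ hκ Z hZ
    (fun s hs hsE A hA => hcond s hs hsE A hA) f hf C hC b hb hfb F ε hε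

end MLBPF

end

/-! ### Signed weights, level averages and the resampling law. -/

noncomputable section

namespace MLBPF

variable {X T : Type*}

lemma measurable_sign : Measurable Real.sign := by
  unfold Real.sign
  exact Measurable.ite measurableSet_Iio measurable_const
    (Measurable.ite measurableSet_Ioi measurable_const measurable_const)

lemma abs_sign_le_one (r : ℝ) : |Real.sign r| ≤ 1 := by
  rcases Real.sign_apply_eq r with h | h | h <;> simp [h]

lemma measurable_levelDiff [MeasurableSpace X] {L : ℕ} {g : Fin (L + 1) → X → ℝ} (hg : ∀ l, Measurable (g l))
    (l : Fin (L + 1)) : Measurable (levelDiff g l) := by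
  unfold levelDiff
  refine (hg l).sub ?_
  cases l using Fin.cases with
  | zero => exact measurable_const
  | succ k => exact hg _

lemma exists_abs_levelDiff_le {L : ℕ} {g : Fin (L + 1) → X → ℝ}
    (hg : ∀ l, ∃ C : ℝ, ∀ x, |g l x| ≤ C) : ∃ D : ℝ, 0 ≤ D ∧ ∀ l x, |levelDiff g l x| ≤ D := by
  choose C hC using hg
  refine ⟨∑ l, |C l| + ∑ l, |C l|, by positivity, fun l x => ?_⟩
  have h : ∀ l, |g l x| ≤ ∑ l, |C l| := fun l => ((hC l x).trans (le_abs_self _)).trans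
    (Finset.single_le_sum (f := fun l => |C l|) (fun _ _ => abs_nonneg _) (Finset.mem_univ l))
  unfold levelDiff
  refine (abs_sub _ _).trans (add_le_add (h l) ?_)
  cases l using Fin.cases with
  | zero => simp; positivity
  | succ k => exact h _

/-- Telescoping, by induction on `L`: without the top level the differences are those of the
truncated family. -/
lemma sum_levelDiff {L : ℕ} (g : Fin (L + 1) → X → ℝ) (x : X) :
    ∑ l, levelDiff g l x = g (Fin.last L) x := by
  induction L with
  | zero => simp [levelDiff]
  | succ L ih =>
    rw [Fin.sum_univ_castSucc]
    have h : ∀ l : Fin (L + 1), levelDiff g l.castSucc x =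
        levelDiff (fun l : Fin (L + 1) => g l.castSucc) l x := by
      intro l
      unfold levelDiff
      cases l using Fin.cases with
      | zero => rfl
      | succ k => rfl
    rw [Finset.sum_congr rfl fun l _ => h l, ih]
    have h' : levelDiff g (Fin.last (L + 1)) x =
        g (Fin.last (L + 1)) x - g (Fin.last L).castSucc x := rfl
    rw [h']
    ring

section Weights

variable {L : ℕ} (g : ℕ → Fin (L + 1) → X → ℝ) (c : Fin (L + 1) → ℕ) (N : ℕ)

lemma abs_resampledSign_le_one (x : Particle c N → X) (wt : Particle c N → ℝ) (z : X) :
    |resampledSign c N x wt z| ≤ 1 :=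
  abs_sign_le_one _

lemma abs_weight_le_one (x xh : ℕ → Particle c N → X) (n : ℕ) (i : Particle c N) :
    |weight g c N x xh n i| ≤ 1 := by
  cases n with
  | zero => simp [weight]
  | succ n => exact abs_resampledSign_le_one _ _ _ _ _

lemma weight_succ (x xh : ℕ → Particle c N → X) (n : ℕ) :
    weight g c N x xh (n + 1) = weightHat g c N x xh n :=
  rfl

/-- Each level contributes at most `D`, whatever `N`. This keeps the factor r_N away from zero after
division by the total variation. -/
lemma sum_abs_weightTilde_le (x xh : ℕ → Particle c N → X) (n : ℕ) {D : ℝ} (hD0 : 0 ≤ D)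
    (hD : ∀ l x, |levelDiff (g n) l x| ≤ D) :
    ∑ i, |weightTilde g c N x xh n i| ≤ (L + 1) * D := by
  rw [Fintype.sum_sigma]
  have h : ∀ l : Fin (L + 1), ∑ k, |weightTilde g c N x xh n ⟨l, k⟩| ≤ D := by
    intro l
    calc ∑ k, |weightTilde g c N x xh n ⟨l, k⟩|
        ≤ ∑ _k : Fin (c l * N), ((c l * N : ℕ) : ℝ)⁻¹ * D := by
          refine Finset.sum_le_sum fun k _ => ?_
          unfold weightTilde updatedWeight
          rw [abs_mul, abs_mul, abs_of_nonneg (a := ((c l * N : ℕ) : ℝ)⁻¹) (by positivity), mul_assoc]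
          refine mul_le_mul_of_nonneg_left ?_ (by positivity)
          calc _ ≤ D * 1 := mul_le_mul (hD _ _) (abs_weight_le_one _ _ _ _ _ _ _)
                (abs_nonneg _) hD0
            _ = D := mul_one D
      _ ≤ D := by
          rw [Finset.sum_const, Finset.card_univ, Fintype.card_fin, nsmul_eq_mul, ← mul_assoc]
          rcases eq_or_ne ((c l * N : ℕ) : ℝ) 0 with h | h
          · simp [h, hD0]
          · rw [mul_inv_cancel₀ h, one_mul]
  refine (Finset.sum_le_sum fun l _ => h l).trans ?_
  simp

/-- If particles at the same place have weights of the same sign, then the sign given to a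
resampled particle is that of its parent. -/
lemma abs_mul_resampledSign (x : Particle c N → X) (wt : Particle c N → ℝ)
    (h : ∀ j k, x j = x k → 0 ≤ wt j * wt k) (j : Particle c N) :
    |wt j| * resampledSign c N x wt (x j) = wt j := by
  classical
  -- Used with s = ±1, the sign of `wt j`: all tied terms times s are nonnegative, so the tie sum
  -- has at least the size of its own term `j` and the same sign.
  have hs : ∀ s : ℝ, (∀ k, x j = x k → 0 ≤ s * wt k) → s * wt j ≤
      s * ∑ k, if x j = x k then wt k else 0 := by
    intro s hs
    rw [Finset.mul_sum]
    refine le_trans (le_of_eq ?_) (Finset.single_le_sum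
      (f := fun k => s * if x j = x k then wt k else 0) (fun k _ => ?_) (Finset.mem_univ j))
    · simp
    · split_ifs with hk
      · exact hs k hk
      · simp
  have he : resampledSign c N x wt (x j) = Real.sign (∑ k, if x j = x k then wt k else 0) := by
    unfold resampledSign
    congr!
  rw [he]
  rcases lt_trichotomy (wt j) 0 with hj | hj | hj
  · have := hs (-1) fun k hk => by nlinarith [h j k hk]
    rw [Real.sign_of_neg (by linarith), abs_of_neg hj]
    ring
  · simp [hj]
  · have := hs 1 fun k hk => by nlinarith [h j k hk]
    rw [Real.sign_of_pos (by linarith), abs_of_pos hj, mul_one]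

lemma resampledSign_nonneg (x : Particle c N → X) (wt : Particle c N → ℝ) (h : ∀ j, 0 ≤ wt j)
    (z : X) : 0 ≤ resampledSign c N x wt z := by
  have hs : ∀ s : ℝ, 0 ≤ s → 0 ≤ Real.sign s := fun s hs => by
    rcases hs.eq_or_lt with h | h
    · rw [← h, Real.sign_zero]
    · rw [Real.sign_of_pos h]
      exact zero_le_one
  refine hs _ (Finset.sum_nonneg fun j _ => ?_)
  split_ifs
  · exact h j
  · exact le_rfl

lemma updatedWeight_nonneg {n : ℕ} (hg : ∀ l x, 0 ≤ levelDiff (g n) l x) (x : Particle c N → X)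
    {w : Particle c N → ℝ} (hw : ∀ i, 0 ≤ w i) (i : Particle c N) :
    0 ≤ updatedWeight g c N n x w i :=
  mul_nonneg (mul_nonneg (by positivity) (hg _ _)) (hw i)

/-- Nonnegative differences never produce a negative sign, so ties are harmless under the second
alternative of the hypotheses. -/
lemma weight_nonneg (hg : ∀ n l x, 0 ≤ levelDiff (g n) l x) (x xh : ℕ → Particle c N → X) (n : ℕ)
    (i : Particle c N) : 0 ≤ weight g c N x xh n i := by
  induction n generalizing i with
  | zero => simp [weight]
  | succ n ih =>
    exact resampledSign_nonneg _ _ _ _ (updatedWeight_nonneg g c N (hg n) _ ih) _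

lemma weightTilde_nonneg (hg : ∀ n l x, 0 ≤ levelDiff (g n) l x) (x xh : ℕ → Particle c N → X)
    (n : ℕ) (i : Particle c N) : 0 ≤ weightTilde g c N x xh n i :=
  updatedWeight_nonneg g c N (hg n) _ (weight_nonneg g c N hg x xh n) i

section Measurability

variable [MeasurableSpace X] [MeasurableSpace T]

lemma measurable_resampledSign [MeasurableEq X] {x : Particle c N → T → X} (hx : ∀ i, Measurable (x i))
    {wt : Particle c N → T → ℝ} (hwt : ∀ i, Measurable (wt i)) :
    Measurable fun p : T × X => resampledSign c N (fun j => x j p.1) (fun j => wt j p.1) p.2 := by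
  unfold resampledSign
  refine measurable_sign.comp (Finset.measurable_sum _ fun j _ => ?_)
  exact Measurable.ite (measurableSet_eq_fun measurable_snd ((hx j).comp measurable_fst))
    ((hwt j).comp measurable_fst) measurable_const

variable {g}

lemma measurable_updatedWeight {n : ℕ} (hg : ∀ l, Measurable (g n l)) {x : Particle c N → T → X}
    (hx : ∀ i, Measurable (x i)) {w : Particle c N → T → ℝ} (hw : ∀ i, Measurable (w i))
    (i : Particle c N) :
    Measurable fun t => updatedWeight g c N n (fun j => x j t) (fun j => w j t) i :=
  (((measurable_levelDiff hg i.1).comp (hx i)).const_mul _).mul (hw i)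

lemma measurable_weight [MeasurableEq X] (hg : ∀ n l, Measurable (g n l)) {x xh : ℕ → Particle c N → T → X} {n : ℕ}
    (hx : ∀ q < n, ∀ i, Measurable (x q i)) (hxh : ∀ q < n, ∀ i, Measurable (xh q i))
    (i : Particle c N) :
    Measurable fun t => weight g c N (fun q j => x q j t) (fun q j => xh q j t) n i := by
  induction n generalizing i with
  | zero => exact measurable_const
  | succ n ih =>
    have ih' := ih (fun q hq => hx q (hq.trans n.lt_succ_self))
      fun q hq => hxh q (hq.trans n.lt_succ_self)
    exact (measurable_resampledSign c N (hx n n.lt_succ_self) (measurable_updatedWeight c N (hg n)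
      (hx n n.lt_succ_self) ih')).comp (measurable_id.prodMk (hxh n n.lt_succ_self i))

lemma measurable_weightTilde [MeasurableEq X] (hg : ∀ n l, Measurable (g n l)) {x xh : ℕ → Particle c N → T → X}
    {n : ℕ} (hx : ∀ q ≤ n, ∀ i, Measurable (x q i)) (hxh : ∀ q < n, ∀ i, Measurable (xh q i))
    (i : Particle c N) :
    Measurable fun t => weightTilde g c N (fun q j => x q j t) (fun q j => xh q j t) n i :=
  measurable_updatedWeight c N (hg n) (hx n le_rfl)
    (measurable_weight c N hg (fun q hq => hx q hq.le) hxh) i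

lemma measurable_weightHat [MeasurableEq X] (hg : ∀ n l, Measurable (g n l)) {x xh : ℕ → Particle c N → T → X}
    {n : ℕ} (hx : ∀ q ≤ n, ∀ i, Measurable (x q i)) (hxh : ∀ q ≤ n, ∀ i, Measurable (xh q i))
    (i : Particle c N) :
    Measurable fun t => weightHat g c N (fun q j => x q j t) (fun q j => xh q j t) n i :=
  measurable_weight c N hg (n := n + 1) (fun q hq => hx q (Nat.lt_succ_iff.1 hq))
    (fun q hq => hxh q (Nat.lt_succ_iff.1 hq)) i

end Measurability

section Law

variable [MeasurableSpace X] [MeasurableSpace T]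

lemma tvMeasure_univ (x : Particle c N → X) (wt : Particle c N → ℝ) :
    tvMeasure c N x wt Set.univ = ENNReal.ofReal (∑ i, |wt i|) := by
  rw [ENNReal.ofReal_sum_of_nonneg fun _ _ => abs_nonneg _]
  simp [tvMeasure]

lemma isProbabilityMeasure_resamplingLaw (x : Particle c N → X) {wt : Particle c N → ℝ}
    (h : ∃ i, wt i ≠ 0) : IsProbabilityMeasure (resamplingLaw c N x wt) := by
  constructor
  obtain ⟨i, hi⟩ := h
  have hpos : 0 < ∑ i, |wt i| := Finset.sum_pos' (fun _ _ => abs_nonneg _)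
    ⟨i, Finset.mem_univ i, abs_pos.2 hi⟩
  rw [resamplingLaw, Measure.smul_apply, tvMeasure_univ, smul_eq_mul]
  exact ENNReal.inv_mul_cancel (by simpa using hpos) ENNReal.ofReal_ne_top

/-- Since points are measurable, integration against a Dirac mass is evaluation for every `f`. If
all weights vanish, both sides are zero. -/
lemma integral_resamplingLaw [MeasurableSingletonClass X] (x : Particle c N → X)
    (wt : Particle c N → ℝ) (f : X → ℝ) :
    ∫ z, f z ∂(resamplingLaw c N x wt) = (∑ i, |wt i|)⁻¹ * ∑ i, |wt i| * f (x i) := by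
  rw [resamplingLaw, integral_smul_measure, tvMeasure_univ, ENNReal.toReal_inv,
    ENNReal.toReal_ofReal (Finset.sum_nonneg fun _ _ => abs_nonneg _), tvMeasure,
    integral_finsetSum_measure, smul_eq_mul]
  · congr 1
    refine Finset.sum_congr rfl fun i _ => ?_
    rw [integral_smul_measure, integral_dirac, ENNReal.toReal_ofReal (abs_nonneg _), smul_eq_mul]
  · intro i _
    exact (integrable_dirac (by simp)).smul_measure ENNReal.ofReal_ne_top

/-- The resampling law, depending on the particles and weights. -/
def resamplingKernel {x : Particle c N → T → X} (hx : ∀ i, Measurable (x i))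
    {wt : Particle c N → T → ℝ} (hwt : ∀ i, Measurable (wt i)) : Kernel T X where
  toFun t := resamplingLaw c N (fun j => x j t) fun j => wt j t
  measurable' := by
    refine Measure.measurable_of_measurable_coe _ fun A hA => ?_
    simp only [resamplingLaw, Measure.smul_apply, tvMeasure_univ, smul_eq_mul]
    simp only [tvMeasure, Measure.finsetSum_apply, Measure.smul_apply, smul_eq_mul]
    refine Measurable.mul (Measurable.inv (Measurable.ennreal_ofReal ?_)) ?_
    · exact Finset.measurable_sum _ fun i _ => (hwt i).norm
    · refine Finset.measurable_sum _ fun i _ => Measurable.mul ?_ ?_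
      · exact Measurable.ennreal_ofReal (hwt i).norm
      · exact (Measure.measurable_coe hA).comp (Measure.measurable_dirac.comp (hx i))

instance {x : Particle c N → T → X} (hx : ∀ i, Measurable (x i))
    {wt : Particle c N → T → ℝ} (hwt : ∀ i, Measurable (wt i)) :
    IsFiniteKernel (resamplingKernel c N hx hwt) := by
  refine ⟨⟨1, ENNReal.one_lt_top, fun t => ?_⟩⟩
  change resamplingLaw c N (fun j => x j t) (fun j => wt j t) Set.univ ≤ 1
  rw [resamplingLaw, Measure.smul_apply, smul_eq_mul]
  exact ENNReal.inv_mul_le_one _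

end Law

/-- The mean of `a` over the particles of level `l`. -/
def levelMean (l : Fin (L + 1)) (a : Particle c N → ℝ) : ℝ :=
  ((c l * N : ℕ) : ℝ)⁻¹ * ∑ k, a ⟨l, k⟩

variable {c N}

lemma levelMean_sub (l : Fin (L + 1)) (a b : Particle c N → ℝ) :
    levelMean c N l (fun i => a i - b i) = levelMean c N l a - levelMean c N l b := by
  simp [levelMean, Finset.sum_sub_distrib, mul_sub]

lemma levelMean_const (hc : ∀ l, 0 < c l) (hN : 1 ≤ N) (l : Fin (L + 1)) (a : ℝ) :
    levelMean c N l (fun _ => a) = a := by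
  have : ((c l * N : ℕ) : ℝ) ≠ 0 := by
    have := hc l
    positivity
  rw [levelMean, Finset.sum_const, Finset.card_univ, Fintype.card_fin, nsmul_eq_mul,
    inv_mul_cancel_left₀ this]

/-- Level sizes are proportional to `N`, so `N` factors out and later cancels in the ratio of two
such sums. -/
lemma sum_eq_sum_levelMean (hc : ∀ l, 0 < c l) (hN : 1 ≤ N) (a : Particle c N → ℝ) :
    ∑ i, a i = N * ∑ l, (c l : ℝ) * levelMean c N l a := by
  rw [Fintype.sum_sigma, Finset.mul_sum]
  refine Finset.sum_congr rfl fun l _ => ?_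
  have h1 : (c l : ℝ) ≠ 0 := by exact_mod_cast (hc l).ne'
  have h2 : (N : ℝ) ≠ 0 := by positivity
  simp only [levelMean, Nat.cast_mul]
  field_simp

/-- The factor N_ℓ⁻¹ in w̃ turns each level's sum into an average, so the levels enter with equal
weight, as telescoping requires. -/
lemma sum_weightTilde_mul (x xh : ℕ → Particle c N → X) (n : ℕ) (φ : X → ℝ) :
    ∑ i, weightTilde g c N x xh n i * φ (x n i) = ∑ l, levelMean c N l fun i =>
      weight g c N x xh n i * (levelDiff (g n) l (x n i) * φ (x n i)) := by
  rw [Fintype.sum_sigma]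
  refine Finset.sum_congr rfl fun l _ => ?_
  rw [levelMean, Finset.mul_sum]
  refine Finset.sum_congr rfl fun k _ => ?_
  simp only [weightTilde, updatedWeight]
  ring

end Weights

end MLBPF

end

/-! ### Histories of the particle system. -/

noncomputable section

namespace MLBPF

variable {X Y Ω T ι : Type*} [MeasurableSpace X] [MeasurableSpace Y] [MeasurableSpace T]

section Histories

variable {mΩ : MeasurableSpace Ω} {ξ ξh : ℕ → ι → Ω → X}

lemma historyBeforeResampling_le (hξ : ∀ n i, Measurable (ξ n i)) (hξh : ∀ n i, Measurable (ξh n i))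
    (n : ℕ) : historyBeforeResampling ξ ξh n ≤ mΩ :=
  sup_le (iSup₂_le fun q _ => iSup_le fun i => (hξ q i).comap_le)
    (iSup₂_le fun q _ => iSup_le fun i => (hξh q i).comap_le)

lemma historyAfterResampling_le (hξ : ∀ n i, Measurable (ξ n i)) (hξh : ∀ n i, Measurable (ξh n i))
    (n : ℕ) : historyAfterResampling ξ ξh n ≤ mΩ :=
  sup_le (iSup₂_le fun q _ => iSup_le fun i => (hξ q i).comap_le)
    (iSup₂_le fun q _ => iSup_le fun i => (hξh q i).comap_le)

omit mΩ in
lemma measurable_historyBeforeResampling_particle {n q : ℕ} (hq : q ≤ n) (i : ι) :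
    Measurable[historyBeforeResampling ξ ξh n] (ξ q i) :=
  Measurable.of_comap_le <| (le_iSup (fun i => MeasurableSpace.comap (ξ q i) _) i).trans <|
    (le_iSup₂ (f := fun q (_ : q ≤ n) => ⨆ i, MeasurableSpace.comap (ξ q i) _) q hq).trans
      le_sup_left

omit mΩ in
lemma measurable_historyBeforeResampling_resampled {n q : ℕ} (hq : q < n) (i : ι) :
    Measurable[historyBeforeResampling ξ ξh n] (ξh q i) :=
  Measurable.of_comap_le <| (le_iSup (fun i => MeasurableSpace.comap (ξh q i) _) i).trans <|
    (le_iSup₂ (f := fun q (_ : q < n) => ⨆ i, MeasurableSpace.comap (ξh q i) _) q hq).trans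
      le_sup_right

omit mΩ in
lemma measurable_historyAfterResampling_particle {n q : ℕ} (hq : q ≤ n) (i : ι) :
    Measurable[historyAfterResampling ξ ξh n] (ξ q i) :=
  Measurable.of_comap_le <| (le_iSup (fun i => MeasurableSpace.comap (ξ q i) _) i).trans <|
    (le_iSup₂ (f := fun q (_ : q ≤ n) => ⨆ i, MeasurableSpace.comap (ξ q i) _) q hq).trans
      le_sup_left

omit mΩ in
lemma measurable_historyAfterResampling_resampled {n q : ℕ} (hq : q ≤ n) (i : ι) :
    Measurable[historyAfterResampling ξ ξh n] (ξh q i) :=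
  Measurable.of_comap_le <| (le_iSup (fun i => MeasurableSpace.comap (ξh q i) _) i).trans <|
    (le_iSup₂ (f := fun q (_ : q ≤ n) => ⨆ i, MeasurableSpace.comap (ξh q i) _) q hq).trans
      le_sup_right

end Histories

/-! ### Absence of ties under diffuse laws. -/

section Ties

variable [MeasurableEq X]

/-- Independent random variables with laws that do not charge points are almost surely distinct. -/
lemma measure_setOf_eq_eq_zero_of_iIndepFun [MeasurableSpace Ω] {P : Measure Ω}
    [IsProbabilityMeasure P] {Z : ι → Ω → X} (hZ : ∀ i, Measurable (Z i)) (hind : iIndepFun Z P)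
    (hP : ∀ i z, P.map (Z i) {z} = 0) {j k : ι} (hjk : j ≠ k) : P {ω | Z j ω = Z k ω} = 0 := by
  have h := (indepFun_iff_map_prod_eq_prod_map_map (hZ j).aemeasurable (hZ k).aemeasurable).1
    (hind.indepFun hjk)
  have : IsProbabilityMeasure (P.map (Z k)) := Measure.isProbabilityMeasure_map (hZ k).aemeasurable
  have hd : MeasurableSet {p : X × X | p.1 = p.2} :=
    measurableSet_eq_fun measurable_fst measurable_snd
  have h1 : P {ω | Z j ω = Z k ω} = P.map (fun ω => (Z j ω, Z k ω)) {p | p.1 = p.2} := by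
    rw [Measure.map_apply ((hZ j).prodMk (hZ k)) hd]
    rfl
  rw [h1, h, Measure.prod_apply hd]
  -- Fubini: each slice of the diagonal is a single point.
  refine (lintegral_congr fun x => ?_).trans lintegral_zero
  refine Eq.trans ?_ (hP k x)
  congr 1
  ext z
  simp [eq_comm]

/-- Given `H`, the variables are coordinates of a product measure; integrating over `H` reduces the
claim to the independent case. -/
lemma measure_setOf_eq_eq_zero_of_cond [MeasurableSpace Ω] [Fintype ι] {P : Measure Ω}
    [IsProbabilityMeasure P] {H : Ω → T} (hH : Measurable H) (κ : ι → Kernel T X)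
    [∀ i, IsMarkovKernel (κ i)] (hκ : ∀ i t z, κ i t {z} = 0) {Z : ι → Ω → X}
    (hZ : ∀ i, Measurable (Z i))
    (hcond : ∀ s, MeasurableSet s → s ⊆ Set.univ → ∀ A : ι → Set X, (∀ i, MeasurableSet (A i)) →
      P (H ⁻¹' s ∩ ⋂ i, Z i ⁻¹' A i) = ∫⁻ ω in H ⁻¹' s, ∏ i, κ i (H ω) (A i) ∂P)
    {j k : ι} (hjk : j ≠ k) : P {ω | Z j ω = Z k ω} = 0 := by
  have h := map_restrict_eq_compProd_piKernel hH MeasurableSet.univ κ hZ hcond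
  simp only [Set.preimage_univ, Measure.restrict_univ] at h
  have hd : MeasurableSet {p : T × (ι → X) | p.2 j = p.2 k} :=
    measurableSet_eq_fun ((measurable_pi_apply j).comp measurable_snd)
      ((measurable_pi_apply k).comp measurable_snd)
  have h1 : P {ω | Z j ω = Z k ω} =
      P.map (fun ω => (H ω, fun i => Z i ω)) {p | p.2 j = p.2 k} := by
    rw [Measure.map_apply (hH.prodMk (measurable_pi_lambda _ hZ)) hd]
    rfl
  rw [h1, h, Measure.compProd_apply hd]
  refine (lintegral_congr fun t => ?_).trans lintegral_zero
  change (Measure.pi fun i => κ i t) {z | z j = z k} = 0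
  refine measure_setOf_eq_eq_zero_of_iIndepFun (Z := fun i (z : ι → X) => z i)
    measurable_pi_apply (iIndepFun_pi (X := fun _ x => x) fun i => aemeasurable_id)
    (fun i z => ?_) hjk
  rw [(measurePreserving_eval (fun i => κ i t) i).map_eq]
  exact hκ i t z

lemma CondIndepLawsOn.measure_setOf_eq_eq_zero {m mΩ : MeasurableSpace Ω} [Fintype ι]
    {P : Measure Ω} [IsProbabilityMeasure P] (hm : m ≤ mΩ) {Z : ι → Ω → X}
    (hZ : ∀ i, Measurable (Z i)) (κ : ι → Kernel[m] Ω X) [∀ i, IsMarkovKernel (κ i)]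
    (hκ : ∀ i ω z, κ i ω {z} = 0)
    (hcond : CondIndepLawsOn P m Set.univ Z fun i ω => κ i ω) {j k : ι} (hjk : j ≠ k) :
    P {ω | Z j ω = Z k ω} = 0 :=
  @measure_setOf_eq_eq_zero_of_cond X Ω Ω ι _ m _ mΩ _ P _ id (measurable_id'' hm) κ _ hκ Z hZ
    (fun s hs hsE A hA => hcond s hs hsE A hA) j k hjk

end Ties

/-! ### Signs at ties and deviation bounds for one run; almost sure limits. -/

section Run

variable [MeasurableSpace Ω] {M : HiddenMarkovModel X Y} {L : ℕ}
  {g : ℕ → Fin (L + 1) → X → ℝ} {c : Fin (L + 1) → ℕ} {N : ℕ} {P : Measure Ω}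
  [IsProbabilityMeasure P] {ξ ξh : ℕ → Particle c N → Ω → X}

/-- If the signal does not charge points, then the particles are almost surely distinct. -/
lemma IsRun.ae_injective [MeasurableEq X] (R : IsRun M g c N P ξ ξh) (hinit : ∀ z, M.init {z} = 0)
    (hK : ∀ x z, M.K x {z} = 0) (n : ℕ) : ∀ᵐ ω ∂P, ∀ j k, ξ n j ω = ξ n k ω → j = k := by
  refine ae_all_iff.2 fun j => ae_all_iff.2 fun k => ?_
  rcases eq_or_ne j k with rfl | hjk
  · exact ae_of_all _ fun _ _ => rfl
  have h0 : P {ω | ξ n j ω = ξ n k ω} = 0 := by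
    cases n with
    | zero =>
      exact measure_setOf_eq_eq_zero_of_iIndepFun (R.measurable_particle 0) R.init_indep
        (fun i z => by rw [R.init_law, hinit]) hjk
    | succ n =>
      have := M.K_markov
      have hm := historyAfterResampling_le R.measurable_particle R.measurable_resampled n
      let κ : Particle c N → Kernel[historyAfterResampling ξ ξh n] Ω X := fun i =>
        @Kernel.comap _ _ _ _ _ (historyAfterResampling ξ ξh n) M.K (ξh n i)
          (measurable_historyAfterResampling_resampled le_rfl i)
      have (i : Particle c N) : IsMarkovKernel (κ i) :=
        ⟨fun ω => inferInstanceAs (IsProbabilityMeasure (M.K (ξh n i ω)))⟩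
      exact CondIndepLawsOn.measure_setOf_eq_eq_zero hm (R.measurable_particle (n + 1)) κ
        (hcond := R.mutate n) (fun i ω z => hK _ z) hjk
  filter_upwards [measure_eq_zero_iff_ae_notMem.1 h0] with ω hω h
  exact absurd h hω

/-- Only here does the dichotomy of the hypotheses act: without ties the product is a square, and
otherwise both factors are nonnegative. -/
lemma IsRun.ae_weightTilde_mul_nonneg [MeasurableEq X] (R : IsRun M g c N P ξ ξh)
    (hties : ((∀ z, M.init {z} = 0) ∧ ∀ x z, M.K x {z} = 0) ∨ ∀ n l x, 0 ≤ levelDiff (g n) l x)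
    (n : ℕ) : ∀ᵐ ω ∂P, ∀ j k, ξ n j ω = ξ n k ω →
      0 ≤ weightTilde g c N (fun q j => ξ q j ω) (fun q j => ξh q j ω) n j *
        weightTilde g c N (fun q j => ξ q j ω) (fun q j => ξh q j ω) n k := by
  rcases hties with ⟨hinit, hK⟩ | hg
  · filter_upwards [R.ae_injective hinit hK n] with ω hω j k hjk
    rw [hω j k hjk]
    exact mul_self_nonneg _
  · exact ae_of_all _ fun ω j k _ =>
      mul_nonneg (weightTilde_nonneg g c N hg _ _ n j) (weightTilde_nonneg g c N hg _ _ n k)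

lemma IsRun.measure_init_le (R : IsRun M g c N P ξ ξh) {ψ : X → ℝ} (hψ : Measurable ψ) {C : ℝ}
    (hC : ∀ x, |ψ x| ≤ C) (l : Fin (L + 1)) {ε : ℝ} (hε : 0 ≤ ε) :
    P {ω | ε * (c l * N : ℕ) ≤ |∑ k, (ψ (ξ 0 ⟨l, k⟩ ω) - ∫ x, ψ x ∂M.init)|} ≤
      ENNReal.ofReal (2 * Real.exp (-(ε ^ 2 / (2 * C ^ 2)) * (c l * N : ℕ))) := by
  have h := measure_abs_sum_sub_integral_ge_le (Z := fun i ω => ψ (ξ 0 i ω))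
    (fun i => hψ.comp (R.measurable_particle 0 i)) (R.init_indep.comp (fun _ => ψ) fun _ => hψ)
    (fun i ω => hC _) (Finset.univ.map (Function.Embedding.sigmaMk l)) hε
  have h1 : ∀ i, ∫ ω, ψ (ξ 0 i ω) ∂P = ∫ x, ψ x ∂M.init := fun i => by
    rw [← R.init_law i,
      integral_map (R.measurable_particle 0 i).aemeasurable hψ.aestronglyMeasurable]
  simpa only [h1, Finset.sum_map, Finset.card_map, Finset.card_univ, Fintype.card_fin] using! h

/-- Given the past, the new weight is a function of the place drawn, so it belongs to the test
function and, having modulus at most one, keeps the bound `C`. All particles share one law, hence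
one conditional mean. -/
lemma IsRun.measure_resample_le [MeasurableEq X] (R : IsRun M g c N P ξ ξh) (hg : ∀ n l, Measurable (g n l))
    {φ : X → ℝ} (hφ : Measurable φ) {C : ℝ} (hC : ∀ x, |φ x| ≤ C) (n : ℕ) (l : Fin (L + 1))
    {ε : ℝ} (hε : 0 ≤ ε) {wt wh : Particle c N → Ω → ℝ}
    (hwt : wt = fun i ω => weightTilde g c N (fun q j => ξ q j ω) (fun q j => ξh q j ω) n i)
    (hwh : wh = fun i ω => weightHat g c N (fun q j => ξ q j ω) (fun q j => ξh q j ω) n i) :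
    P {ω | ω ∈ {ω | ∃ i, wt i ω ≠ 0} ∧ ε * (c l * N : ℕ) ≤
      |∑ k, (wh ⟨l, k⟩ ω * φ (ξh n ⟨l, k⟩ ω) - (∑ i, |wt i ω|)⁻¹ * ∑ i, |wt i ω| *
        (resampledSign c N (fun j => ξ n j ω) (fun j => wt j ω) (ξ n i ω) * φ (ξ n i ω)))|} ≤
      ENNReal.ofReal (2 * Real.exp (-(ε ^ 2 / (2 * C ^ 2)) * (c l * N : ℕ))) := by
  have hm := historyBeforeResampling_le R.measurable_particle R.measurable_resampled n
  have hZ := R.measurable_resampled n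
  have hcond := R.resample n
  set m := historyBeforeResampling ξ ξh n
  have hξm : ∀ q ≤ n, ∀ i, Measurable[m] (ξ q i) := fun q hq i =>
    measurable_historyBeforeResampling_particle hq i
  have hξhm : ∀ q < n, ∀ i, Measurable[m] (ξh q i) := fun q hq i =>
    measurable_historyBeforeResampling_resampled hq i
  have hwtm : ∀ i, Measurable[m] (wt i) := by
    intro i
    rw [hwt]
    exact @measurable_weightTilde X Ω L g c N _ m _ hg ξ ξh n hξm hξhm i
  have hrs := @measurable_resampledSign X Ω L c N _ m _ (ξ n) (hξm n le_rfl) wt hwtm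
  have hE : MeasurableSet[m] {ω | ∃ i, wt i ω ≠ 0} := by
    have : {ω | ∃ i, wt i ω ≠ 0} = ⋃ i, wt i ⁻¹' {0}ᶜ := by
      ext ω
      simp
    rw [this]
    exact MeasurableSet.iUnion fun i => hwtm i (measurableSet_singleton _).compl
  have h := CondIndepLawsOn.measure_abs_sum_sub_ge_le (Z := ξh n) hm hE hZ
    (fun _ => @resamplingKernel X Ω L c N _ m (ξ n) (hξm n le_rfl) wt hwtm)
    (fun _ ω hω => isProbabilityMeasure_resamplingLaw c N _ hω)
    (by subst hwt; exact hcond)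
    (f := fun _ ω z => resampledSign c N (fun j => ξ n j ω) (fun j => wt j ω) z * φ z)
    (fun _ => hrs.mul (hφ.comp measurable_snd)) (C := C)
    (fun _ ω z => by
      rw [abs_mul]
      exact (mul_le_of_le_one_left (abs_nonneg _) (abs_resampledSign_le_one _ _ _ _ _)).trans
        (hC z))
    (b := fun _ ω => (∑ i, |wt i ω|)⁻¹ * ∑ i, |wt i ω| *
      (resampledSign c N (fun j => ξ n j ω) (fun j => wt j ω) (ξ n i ω) * φ (ξ n i ω)))
    (fun _ => by
      refine Measurable.mul (Measurable.inv ?_) ?_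
      · exact Finset.measurable_sum _ fun i _ => (hwtm i).norm
      · refine Finset.measurable_sum _ fun i _ => (hwtm i).norm.mul (Measurable.mul ?_ ?_)
        · exact hrs.comp (measurable_id.prodMk (hξm n le_rfl i))
        · exact hφ.comp (hξm n le_rfl i))
    (fun _ ω _ => integral_resamplingLaw c N _ _ _)
    (Finset.univ.map (Function.Embedding.sigmaMk l)) hε
  subst hwt hwh
  simpa only [Finset.sum_map, Finset.card_map, Finset.card_univ, Fintype.card_fin] using! h

/-- Given the history after resampling, the weights are fixed coefficients of modulus at most one.
The conditional means now vary with the parent. -/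
lemma IsRun.measure_mutate_le [MeasurableEq X] (R : IsRun M g c N P ξ ξh) (hg : ∀ n l, Measurable (g n l))
    {ψ : X → ℝ} (hψ : Measurable ψ) {C : ℝ} (hC : ∀ x, |ψ x| ≤ C) (n : ℕ) (l : Fin (L + 1))
    {ε : ℝ} (hε : 0 ≤ ε) {wh : Particle c N → Ω → ℝ}
    (hwh : wh = fun i ω => weightHat g c N (fun q j => ξ q j ω) (fun q j => ξh q j ω) n i) :
    P {ω | ε * (c l * N : ℕ) ≤ |∑ k, (wh ⟨l, k⟩ ω * ψ (ξ (n + 1) ⟨l, k⟩ ω) -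
        wh ⟨l, k⟩ ω * ∫ z, ψ z ∂M.K (ξh n ⟨l, k⟩ ω))|} ≤
      ENNReal.ofReal (2 * Real.exp (-(ε ^ 2 / (2 * C ^ 2)) * (c l * N : ℕ))) := by
  have := M.K_markov
  have hm := historyAfterResampling_le R.measurable_particle R.measurable_resampled n
  have hZ := R.measurable_particle (n + 1)
  have hcond := R.mutate n
  set m := historyAfterResampling ξ ξh n
  have hξm : ∀ q ≤ n, ∀ i, Measurable[m] (ξ q i) := fun q hq i =>
    measurable_historyAfterResampling_particle hq i
  have hξhm : ∀ q ≤ n, ∀ i, Measurable[m] (ξh q i) := fun q hq i =>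
    measurable_historyAfterResampling_resampled hq i
  have hwhm : ∀ i, Measurable[m] (wh i) := by
    intro i
    rw [hwh]
    exact @measurable_weightHat X Ω L g c N _ m _ hg ξ ξh n hξm hξhm i
  have hψK : Measurable fun x => ∫ z, ψ z ∂M.K x :=
    (hψ.stronglyMeasurable.integral_kernel (κ := M.K)).measurable
  have h := CondIndepLawsOn.measure_abs_sum_sub_ge_le (Z := ξ (n + 1)) (E := Set.univ) hm
    MeasurableSet.univ hZ
    (fun i => @Kernel.comap _ _ _ _ _ m M.K (ξh n i) (hξhm n le_rfl i))
    (fun i ω _ => inferInstanceAs (IsProbabilityMeasure (M.K (ξh n i ω))))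
    hcond (f := fun i ω z => wh i ω * ψ z)
    (fun i => ((hwhm i).comp measurable_fst).mul (hψ.comp measurable_snd)) (C := C)
    (fun i ω z => by
      rw [abs_mul, hwh]
      exact (mul_le_of_le_one_left (abs_nonneg _) (abs_resampledSign_le_one _ _ _ _ _)).trans
        (hC z))
    (b := fun i ω => wh i ω * ∫ z, ψ z ∂M.K (ξh n i ω))
    (fun i => (hwhm i).mul (hψK.comp (hξhm n le_rfl i)))
    (fun i ω _ => integral_const_mul _ _)
    (Finset.univ.map (Function.Embedding.sigmaMk l)) hε
  subst hwh
  simpa only [Finset.sum_map, Finset.card_map, Finset.card_univ, Fintype.card_fin, Set.mem_univ,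
    true_and] using! h

end Run

/-- Averages over a level that satisfy an exponential tail bound tend to zero almost surely. -/
lemma ae_tendsto_levelMean [MeasurableSpace Ω] {P : Measure Ω} [IsProbabilityMeasure P] {L : ℕ}
    {c : Fin (L + 1) → ℕ} (hc : ∀ l, 0 < c l) (l : Fin (L + 1))
    {a : (N : ℕ) → Particle c N → Ω → ℝ} {E : ℕ → Set Ω} (hE : ∀ᵐ ω ∂P, ∀ᶠ N in atTop, ω ∈ E N)
    {C : ℝ} (hC : 0 < C)
    (h : ∀ N, 1 ≤ N → ∀ ε : ℝ, 0 ≤ ε →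
      P {ω | ω ∈ E N ∧ ε * (c l * N : ℕ) ≤ |∑ k, a N ⟨l, k⟩ ω|} ≤
        ENNReal.ofReal (2 * Real.exp (-(ε ^ 2 / (2 * C ^ 2)) * (c l * N : ℕ)))) :
    ∀ᵐ ω ∂P, Tendsto (fun N => levelMean c N l fun i => a N i ω) atTop (𝓝 0) := by
  -- Countably many tolerances 1/(j+1) suffice; Borel–Cantelli treats each one.
  have key : ∀ j : ℕ, ∀ᵐ ω ∂P, ∀ᶠ N in atTop,
      ω ∉ {ω | ω ∈ E N ∧ (1 / ((j : ℝ) + 1)) * (c l * N : ℕ) ≤ |∑ k, a N ⟨l, k⟩ ω|} := by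
    intro j
    set ε : ℝ := 1 / ((j : ℝ) + 1) with hε
    have hεpos : 0 < ε := by positivity
    refine ae_eventually_notMem ?_
    have hsum : Summable fun N : ℕ =>
        2 * Real.exp (-(ε ^ 2 / (2 * C ^ 2)) * (c l * N : ℕ)) := by
      refine Summable.mul_left 2 ?_
      have : (fun N : ℕ => Real.exp (-(ε ^ 2 / (2 * C ^ 2)) * (c l * N : ℕ))) =
          fun N : ℕ => Real.exp (N * (-(ε ^ 2 / (2 * C ^ 2)) * c l)) := by
        funext N
        push_cast
        ring_nf
      rw [this]
      refine Real.summable_exp_nat_mul_iff.2 ?_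
      have h1 : (0 : ℝ) < c l := by exact_mod_cast hc l
      have h2 : 0 < ε ^ 2 / (2 * C ^ 2) := by positivity
      nlinarith
    refine ne_top_of_le_ne_top hsum.tsum_ofReal_ne_top (ENNReal.tsum_le_tsum fun N => ?_)
    -- At `N = 0` the tail bound is not assumed, but the summand is 2 and exceeds any probability.
    rcases Nat.eq_zero_or_pos N with rfl | hN
    · refine prob_le_one.trans ?_
      simp
    · exact h N hN ε hεpos.le
  filter_upwards [ae_all_iff.2 key, hE] with ω hω hωE
  rw [Metric.tendsto_atTop']
  intro ε hε
  obtain ⟨j, hj⟩ := exists_nat_one_div_lt hε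
  obtain ⟨N₀, hN₀⟩ := eventually_atTop.1 ((hω j).and hωE)
  refine ⟨N₀, fun N hN => ?_⟩
  obtain ⟨h1, h2⟩ := hN₀ N hN.le
  have h3 : |∑ k, a N ⟨l, k⟩ ω| < (1 / ((j : ℝ) + 1)) * (c l * N : ℕ) := by
    by_contra! h3
    exact h1 ⟨h2, h3⟩
  have hpos : (0 : ℝ) < (c l * N : ℕ) := by
    exact_mod_cast Nat.mul_pos (hc l) (Nat.zero_lt_of_lt hN)
  rw [Real.dist_eq, sub_zero, levelMean, abs_mul, abs_of_pos (inv_pos.2 hpos)]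
  refine lt_trans ?_ hj
  rw [inv_mul_lt_iff₀ hpos]
  exact h3.trans_eq (mul_comm _ _)

end MLBPF

end

/-! ### The exact filter as a recursion on measures. -/

noncomputable section

namespace MLBPF

variable {X Y Ω : Type*} [MeasurableSpace X] [MeasurableSpace Y]

namespace HiddenMarkovModel

variable (M : HiddenMarkovModel X Y) (y : ℕ → Y)

/-- The unnormalised law of `X_n` given `Y_0 = y_0, …, Y_{n-1} = y_{n-1}`. -/
def prediction : ℕ → Measure X
  | 0 => M.init
  | n + 1 => M.K ∘ₘ (prediction n).withDensity fun x => ENNReal.ofReal (M.g x (y n))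

/-- The unnormalised law of `X_n` given `Y_0 = y_0, …, Y_n = y_n`. -/
def unnormalizedFilter (n : ℕ) : Measure X :=
  (M.prediction y n).withDensity fun x => ENNReal.ofReal (M.g x (y n))

lemma measurable_g_right (z : Y) : Measurable fun x => M.g x z :=
  M.g_measurable.comp measurable_prodMk_right

lemma measurable_likelihood (n : ℕ) : Measurable (M.likelihood y n) :=
  Finset.measurable_prod _ fun k _ =>
    ((M.measurable_g_right (y k)).comp (measurable_pi_apply k)).ennreal_ofReal

lemma measurable_snoc (n : ℕ) :
    Measurable fun p : (Fin (n + 1) → X) × X => (Fin.snoc p.1 p.2 : Fin (n + 2) → X) := by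
  refine measurable_pi_iff.2 fun k => ?_
  cases k using Fin.lastCases with
  | last => simpa using! measurable_snd
  | cast k => simpa using! (measurable_pi_apply k).comp measurable_fst

lemma isProbabilityMeasure_signalLaw (n : ℕ) : IsProbabilityMeasure (M.signalLaw n) := by
  have := M.init_prob
  have := M.K_markov
  induction n with
  | zero => exact Measure.isProbabilityMeasure_map (by fun_prop)
  | succ n ih => exact Measure.isProbabilityMeasure_map (measurable_snoc n).aemeasurable

lemma lintegral_unnormalizedFilter (n : ℕ) {f : X → ℝ≥0∞} (hf : Measurable f) :
    ∫⁻ x, f x ∂M.unnormalizedFilter y n =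
      ∫⁻ x, ENNReal.ofReal (M.g x (y n)) * f x ∂M.prediction y n :=
  lintegral_withDensity_eq_lintegral_mul _ (M.measurable_g_right _).ennreal_ofReal hf

/-- Integrating out the last coordinate of the path replaces f by K(g f) one step earlier; hence the
induction is over all `f`. -/
lemma lintegral_likelihood_mul (n : ℕ) {f : X → ℝ≥0∞} (hf : Measurable f) :
    ∫⁻ x, M.likelihood y n x * f (x (Fin.last n)) ∂M.signalLaw n =
      ∫⁻ x, f x ∂M.unnormalizedFilter y n := by
  have := M.K_markov
  induction n generalizing f with
  | zero =>
    have hm : Measurable fun x : Fin 1 → X => M.likelihood y 0 x * f (x (Fin.last 0)) :=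
      (M.measurable_likelihood y 0).mul (hf.comp (measurable_pi_apply _))
    rw [lintegral_unnormalizedFilter _ _ _ hf, signalLaw,
      lintegral_map hm (measurable_pi_lambda (fun (x : X) (_ : Fin 1) => x) fun _ => measurable_id)]
    simp [likelihood, prediction]
  | succ n ih =>
    have := M.isProbabilityMeasure_signalLaw n
    have hg := (M.measurable_g_right (y (n + 1))).ennreal_ofReal
    have hgf : Measurable fun x => ENNReal.ofReal (M.g x (y (n + 1))) * f x := hg.mul hf
    have hm : Measurable fun x : Fin (n + 2) → X => M.likelihood y (n + 1) x * f (x (Fin.last _)) :=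
      (M.measurable_likelihood y (n + 1)).mul (hf.comp (measurable_pi_apply _))
    have hm' : Measurable fun p : (Fin (n + 1) → X) × X =>
        M.likelihood y (n + 1) (Fin.snoc p.1 p.2) *
          f ((Fin.snoc p.1 p.2 : Fin (n + 2) → X) (Fin.last _)) := hm.comp (measurable_snoc n)
    rw [lintegral_unnormalizedFilter _ _ _ hf, signalLaw, lintegral_map hm (measurable_snoc n),
      Measure.lintegral_compProd hm']
    have h : ∀ x : Fin (n + 1) → X, ∫⁻ z, M.likelihood y (n + 1) (Fin.snoc x z : Fin (n + 2) → X) *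
        f ((Fin.snoc x z : Fin (n + 2) → X) (Fin.last _)) ∂M.K (x (Fin.last n)) =
        M.likelihood y n x *
          ∫⁻ z, ENNReal.ofReal (M.g z (y (n + 1))) * f z ∂M.K (x (Fin.last n)) := by
      intro x
      rw [← lintegral_const_mul _ (hgf)]
      refine lintegral_congr fun z => ?_
      rw [likelihood, Fin.prod_univ_castSucc]
      simp only [Fin.snoc_castSucc, Fin.snoc_last, likelihood, Fin.val_castSucc, Fin.val_last]
      ring
    calc _ = ∫⁻ x, M.likelihood y n x *
          (fun x' => ∫⁻ z, ENNReal.ofReal (M.g z (y (n + 1))) * f z ∂M.K x') (x (Fin.last n))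
            ∂M.signalLaw n := lintegral_congr h
      _ = _ := by
        rw [ih (hgf).lintegral_kernel, prediction,
          Measure.lintegral_bind M.K.aemeasurable (hgf).aemeasurable]
        rfl

lemma filter_eq (n : ℕ) :
    M.filter y n = (M.unnormalizedFilter y n Set.univ)⁻¹ • M.unnormalizedFilter y n := by
  have h1 : ∫⁻ x, M.likelihood y n x ∂M.signalLaw n = M.unnormalizedFilter y n Set.univ := by
    simpa using M.lintegral_likelihood_mul y n (f := fun _ => 1) measurable_const
  have h2 : ((M.signalLaw n).withDensity (M.likelihood y n)).map (fun x => x (Fin.last n)) =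
      M.unnormalizedFilter y n := by
    refine Measure.ext_of_lintegral _ fun f hf => ?_
    rw [lintegral_map hf (measurable_pi_apply _), ← M.lintegral_likelihood_mul y n hf]
    exact lintegral_withDensity_eq_lintegral_mul _ (M.measurable_likelihood y n)
      (hf.comp (measurable_pi_apply _))
  rw [HiddenMarkovModel.filter, h1, h2]

lemma integral_filter (n : ℕ) (φ : X → ℝ) : ∫ x, φ x ∂M.filter y n =
    (∫ x, φ x ∂M.unnormalizedFilter y n) / (M.unnormalizedFilter y n).real Set.univ := by
  rw [filter_eq, integral_smul_measure, smul_eq_mul, ENNReal.toReal_inv, div_eq_inv_mul]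
  rfl

variable {M y}

lemma isFiniteMeasure_prediction (hg : ∀ n, ∃ C : ℝ, ∀ x, M.g x (y n) ≤ C) (n : ℕ) :
    IsFiniteMeasure (M.prediction y n) := by
  have := M.init_prob
  have := M.K_markov
  induction n with
  | zero => exact inferInstanceAs (IsFiniteMeasure M.init)
  | succ n ih =>
    obtain ⟨C, hC⟩ := hg n
    have : IsFiniteMeasure
        ((M.prediction y n).withDensity fun x => ENNReal.ofReal (M.g x (y n))) := by
      refine isFiniteMeasure_withDensity (ne_top_of_le_ne_top ?_
        (lintegral_mono fun x => ENNReal.ofReal_le_ofReal (hC x)))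
      rw [lintegral_const]
      exact ENNReal.mul_ne_top ENNReal.ofReal_ne_top (measure_ne_top _ _)
    exact inferInstanceAs (IsFiniteMeasure (M.K ∘ₘ _))

/-- A Markov kernel preserves mass, so this mass equals that of the next prediction. -/
lemma isFiniteMeasure_unnormalizedFilter (hg : ∀ n, ∃ C : ℝ, ∀ x, M.g x (y n) ≤ C) (n : ℕ) :
    IsFiniteMeasure (M.unnormalizedFilter y n) := by
  have := isFiniteMeasure_prediction hg (n + 1)
  have := M.K_markov
  refine ⟨lt_of_eq_of_lt ?_ (measure_lt_top (M.prediction y (n + 1)) Set.univ)⟩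
  rw [prediction, Measure.bind_apply MeasurableSet.univ M.K.aemeasurable]
  simp [unnormalizedFilter]

/-- A strictly positive density cannot annihilate a nonzero measure, and a Markov kernel preserves
mass. -/
lemma unnormalizedFilter_univ_ne_zero (hpos : ∀ n x, 0 < M.g x (y n)) (n : ℕ) :
    M.unnormalizedFilter y n Set.univ ≠ 0 := by
  have := M.K_markov
  have key : ∀ n, M.prediction y n ≠ 0 → M.unnormalizedFilter y n Set.univ ≠ 0 := by
    intro n hn h
    rw [unnormalizedFilter, withDensity_apply _ MeasurableSet.univ, Measure.restrict_univ,
      lintegral_eq_zero_iff (M.measurable_g_right _).ennreal_ofReal] at h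
    refine hn (ae_eq_bot.1 (eventually_false_iff_eq_bot.1 (h.mono fun x hx => ?_)))
    exact (hpos n x).not_ge (by simpa using hx)
  refine key n ?_
  induction n with
  | zero =>
    have := M.init_prob
    exact IsProbabilityMeasure.ne_zero M.init
  | succ n ih =>
    intro h
    refine key n ih ?_
    have h1 : M.prediction y (n + 1) Set.univ = 0 := by simp [h]
    rw [prediction, Measure.bind_apply MeasurableSet.univ M.K.aemeasurable] at h1
    simpa [unnormalizedFilter] using h1

lemma integral_unnormalizedFilter (n : ℕ) (φ : X → ℝ) :
    ∫ x, φ x ∂M.unnormalizedFilter y n = ∫ x, M.g x (y n) * φ x ∂M.prediction y n := by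
  rw [unnormalizedFilter, integral_withDensity_eq_integral_toReal_smul
    (M.measurable_g_right _).ennreal_ofReal (ae_of_all _ fun _ => ENNReal.ofReal_lt_top)]
  refine integral_congr_ae (ae_of_all _ fun x => ?_)
  simp [ENNReal.toReal_ofReal (M.g_nonneg _ _)]

lemma integral_prediction_succ (n : ℕ) {φ : X → ℝ}
    (hφ : Integrable φ (M.prediction y (n + 1))) :
    ∫ x, φ x ∂M.prediction y (n + 1) = ∫ x, ∫ z, φ z ∂M.K x ∂M.unnormalizedFilter y n := by
  rw [prediction, Measure.comp_eq_comp_const_apply] at hφ ⊢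
  rw [Kernel.integral_comp hφ, Kernel.const_apply]
  rfl

end HiddenMarkovModel

end MLBPF

end

/-! ### Propagation of the approximation on levels through the algorithm. -/

noncomputable section

namespace MLBPF

variable {X Y Ω : Type*}

/-- A lower bound on `u` is enough, so normalising factors need not converge. -/
lemma tendsto_inv_mul_zero {u v : ℕ → ℝ} {δ : ℝ} (hδ : 0 < δ) (hu : ∀ᶠ N in atTop, δ ≤ u N)
    (hv : Tendsto v atTop (𝓝 0)) : Tendsto (fun N => (u N)⁻¹ * v N) atTop (𝓝 0) := by
  refine squeeze_zero_norm' (a := fun N => δ⁻¹ * ‖v N‖) ?_ (by simpa using hv.norm.const_mul δ⁻¹)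
  filter_upwards [hu] with N hN
  rw [norm_mul, norm_inv, Real.norm_eq_abs, abs_of_pos (hδ.trans_le hN)]
  gcongr

lemma exists_pos_abs_le {ψ : X → ℝ} (hC : ∃ C : ℝ, ∀ x, |ψ x| ≤ C) :
    ∃ C : ℝ, 0 < C ∧ ∀ x, |ψ x| ≤ C := by
  obtain ⟨C, hC⟩ := hC
  exact ⟨max C 1, by positivity, fun x => (hC x).trans (le_max_left _ _)⟩

lemma exists_abs_mul_le {ψ φ : X → ℝ} (hψ : ∃ C : ℝ, ∀ x, |ψ x| ≤ C)
    (hφ : ∃ C : ℝ, ∀ x, |φ x| ≤ C) : ∃ C : ℝ, ∀ x, |ψ x * φ x| ≤ C := by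
  obtain ⟨C, hC0, hC⟩ := exists_pos_abs_le hψ
  obtain ⟨D, hD⟩ := hφ
  exact ⟨C * D, fun x => by
    rw [abs_mul]
    exact mul_le_mul (hC x) (hD x) (abs_nonneg _) hC0.le⟩

variable [MeasurableSpace X] [MeasurableSpace Y] [MeasurableSpace Ω]

lemma integrable_of_abs_le {ν : Measure X} [IsFiniteMeasure ν] {ψ : X → ℝ} (hψ : Measurable ψ)
    (hC : ∃ C : ℝ, ∀ x, |ψ x| ≤ C) : Integrable ψ ν := by
  obtain ⟨C, hC⟩ := hC
  exact Integrable.of_bound hψ.aestronglyMeasurable C (ae_of_all _ hC)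

variable {L : ℕ} {c : Fin (L + 1) → ℕ}

/-- On each level, the weighted empirical measures of the particles `ζ N i` with weights `w N i`
are almost surely asymptotic to multiples of `ν`, with factors that stay away from zero and do not
depend on the level. -/
def ApproximatesOnLevels (P : Measure Ω) (w : (N : ℕ) → Particle c N → Ω → ℝ)
    (ζ : (N : ℕ) → Particle c N → Ω → X) (ν : Measure X) : Prop :=
  ∃ r : ℕ → Ω → ℝ, (∀ᵐ ω ∂P, ∃ δ > 0, ∀ᶠ N in atTop, δ ≤ r N ω) ∧
    ∀ ψ : X → ℝ, Measurable ψ → (∃ C : ℝ, ∀ x, |ψ x| ≤ C) → ∀ l, ∀ᵐ ω ∂P,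
      Tendsto (fun N => levelMean c N l (fun i => w N i ω * ψ (ζ N i ω)) - r N ω * ∫ x, ψ x ∂ν)
        atTop (𝓝 0)

variable {M : HiddenMarkovModel X Y} {y : ℕ → Y} {g : ℕ → Fin (L + 1) → X → ℝ} {P : Measure Ω}
  {ξ ξh : (N : ℕ) → ℕ → Particle c N → Ω → X}

lemma approximatesOnLevels_init [IsProbabilityMeasure P] (hc : ∀ l, 0 < c l)
    (hrun : ∀ N, 1 ≤ N → IsRun M g c N P (ξ N) (ξh N)) :
    ApproximatesOnLevels P
      (fun N i ω => weight g c N (fun q j => ξ N q j ω) (fun q j => ξh N q j ω) 0 i)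
      (fun N => ξ N 0) M.init := by
  refine ⟨fun _ _ => 1, ae_of_all _ fun _ => ⟨1, one_pos, by simp⟩, fun ψ hψ hC l => ?_⟩
  obtain ⟨C, hC0, hC⟩ := exists_pos_abs_le hC
  have h := ae_tendsto_levelMean (P := P) hc l (E := fun _ => Set.univ) (by simp) hC0
    (a := fun N i ω => ψ (ξ N 0 i ω) - ∫ x, ψ x ∂M.init)
    (fun N hN ε hε => by simpa using! (hrun N hN).measure_init_le hψ hC l hε)
  filter_upwards [h] with ω hω
  refine hω.congr' ?_
  filter_upwards [eventually_ge_atTop 1] with N hN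
  rw [levelMean_sub, levelMean_const hc hN]
  simp [weight]

/-- The test function ψ is pulled back to Kψ, again bounded and measurable, with a vanishing
Hoeffding error; the factor r_N is unchanged. -/
lemma ApproximatesOnLevels.mutate [MeasurableEq X] [IsProbabilityMeasure P] (hc : ∀ l, 0 < c l)
    (hg : ∀ n l, Measurable (g n l))
    (hrun : ∀ N, 1 ≤ N → IsRun M g c N P (ξ N) (ξh N)) {n : ℕ}
    [IsFiniteMeasure (M.prediction y (n + 1))]
    (h : ApproximatesOnLevels P
      (fun N i ω => weightHat g c N (fun q j => ξ N q j ω) (fun q j => ξh N q j ω) n i)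
      (fun N => ξh N n) (M.unnormalizedFilter y n)) :
    ApproximatesOnLevels P
      (fun N i ω => weight g c N (fun q j => ξ N q j ω) (fun q j => ξh N q j ω) (n + 1) i)
      (fun N => ξ N (n + 1)) (M.prediction y (n + 1)) := by
  have := M.K_markov
  obtain ⟨r, hr, h⟩ := h
  refine ⟨r, hr, fun ψ hψ hC l => ?_⟩
  have hint := HiddenMarkovModel.integral_prediction_succ (M := M) (y := y) n
    (integrable_of_abs_le hψ hC)
  obtain ⟨C, hC0, hC⟩ := exists_pos_abs_le hC
  have hψK : Measurable fun x => ∫ z, ψ z ∂M.K x :=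
    (hψ.stronglyMeasurable.integral_kernel (κ := M.K)).measurable
  have h1 := h (fun x => ∫ z, ψ z ∂M.K x) hψK ⟨C, fun x => by
    simpa using norm_integral_le_of_norm_le_const (μ := M.K x) (f := ψ) (ae_of_all _ hC)⟩ l
  have h2 := ae_tendsto_levelMean (P := P) hc l (E := fun _ => Set.univ) (by simp) hC0
    (fun N hN ε hε => by simpa using! (hrun N hN).measure_mutate_le hg hψ hC n l hε rfl)
    (a := fun N i ω =>
      weightHat g c N (fun q j => ξ N q j ω) (fun q j => ξh N q j ω) n i * ψ (ξ N (n + 1) i ω) -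
      weightHat g c N (fun q j => ξ N q j ω) (fun q j => ξh N q j ω) n i *
        ∫ z, ψ z ∂M.K (ξh N n i ω))
  filter_upwards [h1, h2] with ω h1 h2
  refine (by simpa using h2.add h1 : Tendsto _ _ _).congr fun N => ?_
  rw [levelMean_sub, hint, weight_succ]
  ring

/-- The weighted empirical measures of all particles before resampling. -/
lemma ApproximatesOnLevels.ae_tendsto_sum_weightTilde
    (hg_meas : ∀ n l, Measurable (g n l)) (hg_bdd : ∀ n l, ∃ C : ℝ, ∀ x, |g n l x| ≤ C)
    (hg_last : ∀ n x, g n (Fin.last L) x = M.g x (y n)) {n : ℕ}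
    [IsFiniteMeasure (M.prediction y n)] {r : ℕ → Ω → ℝ}
    (h : ∀ ψ : X → ℝ, Measurable ψ → (∃ C : ℝ, ∀ x, |ψ x| ≤ C) → ∀ l, ∀ᵐ ω ∂P,
      Tendsto (fun N => levelMean c N l (fun i =>
        weight g c N (fun q j => ξ N q j ω) (fun q j => ξh N q j ω) n i * ψ (ξ N n i ω)) -
          r N ω * ∫ x, ψ x ∂M.prediction y n) atTop (𝓝 0))
    {φ : X → ℝ} (hφ : Measurable φ) (hC : ∃ C : ℝ, ∀ x, |φ x| ≤ C) : ∀ᵐ ω ∂P,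
      Tendsto (fun N => ∑ i, weightTilde g c N (fun q j => ξ N q j ω) (fun q j => ξh N q j ω) n i *
        φ (ξ N n i ω) - r N ω * ∫ x, φ x ∂M.unnormalizedFilter y n) atTop (𝓝 0) := by
  obtain ⟨D, -, hD⟩ := exists_abs_levelDiff_le (hg_bdd n)
  have hm : ∀ l, Measurable fun x => levelDiff (g n) l x * φ x := fun l =>
    (measurable_levelDiff (hg_meas n) l).mul hφ
  have hb : ∀ l, ∃ C : ℝ, ∀ x, |levelDiff (g n) l x * φ x| ≤ C := fun l =>
    exists_abs_mul_le ⟨D, hD l⟩ hC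
  have hint : ∫ x, φ x ∂M.unnormalizedFilter y n =
      ∑ l, ∫ x, levelDiff (g n) l x * φ x ∂M.prediction y n := by
    rw [HiddenMarkovModel.integral_unnormalizedFilter,
      ← integral_finsetSum _ fun l _ => integrable_of_abs_le (hm l) (hb l)]
    refine integral_congr_ae (ae_of_all _ fun x => ?_)
    simp only
    rw [← Finset.sum_mul, sum_levelDiff, hg_last]
  filter_upwards [ae_all_iff.2 fun l => h _ (hm l) (hb l) l] with ω hω
  have h1 := tendsto_finsetSum Finset.univ fun l _ => hω l
  rw [Finset.sum_const_zero] at h1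
  refine h1.congr fun N => ?_
  rw [Finset.sum_sub_distrib, ← Finset.mul_sum, hint,
    sum_weightTilde_mul g (fun q j => ξ N q j ω) (fun q j => ξh N q j ω) n φ]

/-- Every level is redrawn from the same mixture over all levels, so each one now approximates the
full telescoped measure. The new factor is r_N / ∑|w̃|. -/
lemma ApproximatesOnLevels.resample [MeasurableEq X] [IsProbabilityMeasure P] (hc : ∀ l, 0 < c l)
    (hpos : ∀ n x, 0 < M.g x (y n))
    (hg_meas : ∀ n l, Measurable (g n l)) (hg_bdd : ∀ n l, ∃ C : ℝ, ∀ x, |g n l x| ≤ C)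
    (hg_last : ∀ n x, g n (Fin.last L) x = M.g x (y n))
    (hties : ((∀ z, M.init {z} = 0) ∧ ∀ x z, M.K x {z} = 0) ∨ ∀ n l x, 0 ≤ levelDiff (g n) l x)
    (hrun : ∀ N, 1 ≤ N → IsRun M g c N P (ξ N) (ξh N)) {n : ℕ}
    [IsFiniteMeasure (M.prediction y n)] [IsFiniteMeasure (M.unnormalizedFilter y n)]
    (h : ApproximatesOnLevels P
      (fun N i ω => weight g c N (fun q j => ξ N q j ω) (fun q j => ξh N q j ω) n i)
      (fun N => ξ N n) (M.prediction y n)) :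
    ApproximatesOnLevels P
      (fun N i ω => weightHat g c N (fun q j => ξ N q j ω) (fun q j => ξh N q j ω) n i)
      (fun N => ξh N n) (M.unnormalizedFilter y n) := by
  obtain ⟨r, hr, h⟩ := h
  obtain ⟨D, hD0, hD⟩ := exists_abs_levelDiff_le (hg_bdd n)
  set wt : (N : ℕ) → Particle c N → Ω → ℝ := fun N i ω =>
    weightTilde g c N (fun q j => ξ N q j ω) (fun q j => ξh N q j ω) n i with hwt
  have hμ : ∀ φ : X → ℝ, Measurable φ → (∃ C : ℝ, ∀ x, |φ x| ≤ C) → ∀ᵐ ω ∂P, Tendsto (fun N =>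
      ∑ i, wt N i ω * φ (ξ N n i ω) - r N ω * ∫ x, φ x ∂M.unnormalizedFilter y n)
      atTop (𝓝 0) := fun φ hφ hC =>
    ApproximatesOnLevels.ae_tendsto_sum_weightTilde hg_meas hg_bdd hg_last h hφ hC
  have hΓ : 0 < (M.unnormalizedFilter y n).real Set.univ :=
    ENNReal.toReal_pos (M.unnormalizedFilter_univ_ne_zero hpos n) (measure_ne_top _ _)
  have htv : ∀ᵐ ω ∂P, ∃ δ > 0, ∀ᶠ N in atTop, δ ≤ ∑ i, |wt N i ω| := by
    filter_upwards [hr, hμ (fun _ => 1) measurable_const ⟨1, by simp⟩] with ω ⟨δ, hδ, hrδ⟩ hω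
    -- The signed sum is eventually within half of this lower bound for r_N times the mass, and
    -- ∑|w̃| dominates it.
    refine ⟨δ * (M.unnormalizedFilter y n).real Set.univ / 2, by positivity, ?_⟩
    have hlt : -(δ * (M.unnormalizedFilter y n).real Set.univ / 2) < 0 := by
      have : 0 < δ * (M.unnormalizedFilter y n).real Set.univ / 2 := by positivity
      linarith
    filter_upwards [hrδ, hω.eventually (lt_mem_nhds hlt)] with N hN1 hN2
    have h1 : ∑ i, wt N i ω ≤ ∑ i, |wt N i ω| := Finset.sum_le_sum fun i _ => le_abs_self _
    have h2 := mul_le_mul_of_nonneg_right hN1 hΓ.le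
    simp only [mul_one, integral_const, smul_eq_mul] at hN2
    linarith
  have hties' : ∀ᵐ ω ∂P, ∀ N, 1 ≤ N → ∀ j k, ξ N n j ω = ξ N n k ω → 0 ≤ wt N j ω * wt N k ω :=
    ae_all_iff.2 fun N => by
      by_cases hN : 1 ≤ N
      · filter_upwards [(hrun N hN).ae_weightTilde_mul_nonneg hties n] with ω hω _ using hω
      · exact ae_of_all _ fun ω h => absurd h hN
  refine ⟨fun N ω => (∑ i, |wt N i ω|)⁻¹ * r N ω, ?_, fun φ hφ hC l => ?_⟩
  · filter_upwards [hr, htv] with ω ⟨δ, hδ, hrδ⟩ ⟨δ', hδ', htvδ⟩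
    -- The added 1 keeps the denominator positive when `D = 0`.
    refine ⟨((L + 1) * D + 1)⁻¹ * δ, by positivity, ?_⟩
    filter_upwards [hrδ, htvδ] with N h1 h2
    have h3 : ∑ i, |wt N i ω| ≤ (L + 1) * D + 1 :=
      (sum_abs_weightTilde_le g c N _ _ n hD0 hD).trans (by linarith)
    exact mul_le_mul (inv_anti₀ (hδ'.trans_le h2) h3) h1 hδ.le
      (inv_nonneg.2 (hδ'.le.trans h2))
  · have hlim := hμ φ hφ hC
    obtain ⟨C, hC0, hC⟩ := exists_pos_abs_le hC
    have h1 := ae_tendsto_levelMean (P := P) hc l (E := fun N => {ω | ∃ i, wt N i ω ≠ 0}) ?_ hC0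
      (fun N hN ε hε => (hrun N hN).measure_resample_le hg_meas hφ hC n l hε (wt := wt N)
        (wh := fun i ω => weightHat g c N (fun q j => ξ N q j ω) (fun q j => ξh N q j ω) n i)
        rfl rfl)
      (a := fun N i ω =>
        weightHat g c N (fun q j => ξ N q j ω) (fun q j => ξh N q j ω) n i * φ (ξh N n i ω) -
        (∑ i, |wt N i ω|)⁻¹ * ∑ i, |wt N i ω| * (resampledSign c N (fun j => ξ N n j ω)
          (fun j => wt N j ω) (ξ N n i ω) * φ (ξ N n i ω)))
    · filter_upwards [h1, hlim, htv, hties'] with ω h1 hlim ⟨δ, hδ, htvδ⟩ hω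
      -- The sampling error around the conditional mean plus the normalised error of that mean.
      have h2 := h1.add (tendsto_inv_mul_zero hδ htvδ hlim)
      rw [add_zero] at h2
      refine h2.congr' ?_
      filter_upwards [eventually_ge_atTop 1] with N hN
      have h3 : ∀ i, |wt N i ω| * (resampledSign c N (fun j => ξ N n j ω)
          (fun j => wt N j ω) (ξ N n i ω) * φ (ξ N n i ω)) = wt N i ω * φ (ξ N n i ω) := fun i => by
        rw [← mul_assoc, abs_mul_resampledSign c N (fun j => ξ N n j ω) (fun j => wt N j ω)
          (hω N hN) i]
      simp only [h3]
      rw [levelMean_sub, levelMean_const hc hN]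
      ring
    -- The event on which the resampling law is defined eventually holds, since ∑|w̃| stays
    -- positive.
    · filter_upwards [htv] with ω ⟨δ, hδ, htvδ⟩
      filter_upwards [htvδ] with N hN
      by_contra h0
      have h1 : ∀ i, wt N i ω = 0 := fun i => by_contra fun hi => h0 ⟨i, hi⟩
      simp only [h1, abs_zero, Finset.sum_const_zero] at hN
      exact hN.not_gt hδ

/-- Numerator and denominator, divided by N r_N, converge to ∑c_ℓ times the integrals of φ and 1;
the common factors cancel. -/
lemma ApproximatesOnLevels.ae_tendsto_ratio (hc : ∀ l, 0 < c l) {ν : Measure X}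
    (hν : ν.real Set.univ ≠ 0) {w : (N : ℕ) → Particle c N → Ω → ℝ}
    {ζ : (N : ℕ) → Particle c N → Ω → X} (h : ApproximatesOnLevels P w ζ ν) {φ : X → ℝ}
    (hφ : Measurable φ) (hC : ∃ C : ℝ, ∀ x, |φ x| ≤ C) :
    ∀ᵐ ω ∂P, Tendsto (fun N => (∑ i, w N i ω * φ (ζ N i ω)) / ∑ i, w N i ω) atTop
      (𝓝 ((∫ x, φ x ∂ν) / ν.real Set.univ)) := by
  obtain ⟨r, hr, h⟩ := h
  have hlim : ∀ ψ : X → ℝ, Measurable ψ → (∃ C : ℝ, ∀ x, |ψ x| ≤ C) → ∀ᵐ ω ∂P,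
      Tendsto (fun N => (r N ω)⁻¹ * ∑ l, (c l : ℝ) *
        levelMean c N l (fun i => w N i ω * ψ (ζ N i ω))) atTop
        (𝓝 ((∑ l, (c l : ℝ)) * ∫ x, ψ x ∂ν)) := by
    intro ψ hψ hψC
    filter_upwards [ae_all_iff.2 fun l => h ψ hψ hψC l, hr] with ω hω ⟨δ, hδ, hrδ⟩
    have h1 := tendsto_finsetSum Finset.univ fun l _ => (hω l).const_mul (c l : ℝ)
    simp only [mul_zero, Finset.sum_const_zero] at h1
    have h2 := (tendsto_inv_mul_zero hδ hrδ h1).add_const ((∑ l, (c l : ℝ)) * ∫ x, ψ x ∂ν)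
    rw [zero_add] at h2
    refine h2.congr' ?_
    filter_upwards [hrδ] with N hN
    have hr0 : r N ω ≠ 0 := (hδ.trans_le hN).ne'
    simp only [mul_sub, Finset.sum_sub_distrib, mul_left_comm _ (r N ω)]
    rw [← Finset.mul_sum, inv_mul_cancel_left₀ hr0, Finset.sum_mul]
    ring
  have hcs : (∑ l, (c l : ℝ)) ≠ 0 :=
    (Finset.sum_pos (fun l _ => Nat.cast_pos.2 (hc l)) Finset.univ_nonempty).ne'
  filter_upwards [hlim φ hφ hC, hlim (fun _ => 1) measurable_const ⟨1, by simp⟩, hr] with ω h1 h2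
    ⟨δ, hδ, hrδ⟩
  simp only [mul_one, integral_const, smul_eq_mul] at h2
  have h3 := h1.div h2 (mul_ne_zero hcs hν)
  rw [mul_div_mul_left _ _ hcs] at h3
  refine h3.congr' ?_
  filter_upwards [hrδ, eventually_ge_atTop 1] with N hN1 hN2
  have hr0 : (r N ω)⁻¹ ≠ 0 := inv_ne_zero (hδ.trans_le hN1).ne'
  have hN0 : (N : ℝ) ≠ 0 := by positivity
  simp only [Pi.div_apply]
  rw [mul_div_mul_left _ _ hr0, sum_eq_sum_levelMean hc hN2 fun i => w N i ω * φ (ζ N i ω),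
    sum_eq_sum_levelMean hc hN2 fun i => w N i ω, mul_div_mul_left _ _ hN0]

end MLBPF

end

theorem theorem1 {X Y Ω : Type*} [MeasurableSpace X] [MeasurableEq X] [MeasurableSpace Y]
    [MeasurableSpace Ω]
    -- the hidden Markov model and the fixed observations
    (M : MLBPF.HiddenMarkovModel X Y) (y : ℕ → Y)
    (hpos : ∀ n x, 0 < M.g x (y n))
    -- the approximations of the likelihoods; the highest level is exact
    {L : ℕ} (g : ℕ → Fin (L + 1) → X → ℝ)
    (hg_meas : ∀ n l, Measurable (g n l))
    (hg_bdd : ∀ n l, ∃ C : ℝ, ∀ x, |g n l x| ≤ C)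
    (hg_last : ∀ n x, g n (Fin.last L) x = M.g x (y n))
    -- particles with weights of opposite signs do not meet: the signal does not charge points,
    -- unless no negative weight can occur
    (hties : ((∀ z, M.init {z} = 0) ∧ ∀ x z, M.K x {z} = 0) ∨
      ∀ n l x, 0 ≤ MLBPF.levelDiff (g n) l x)
    (c : Fin (L + 1) → ℕ) (hc : ∀ l, 0 < c l)
    -- for every `N ≥ 1` a run of the algorithm, all of them on one probability space
    (P : Measure Ω) [IsProbabilityMeasure P]
    (ξ ξh : (N : ℕ) → ℕ → MLBPF.Particle c N → Ω → X)
    (hrun : ∀ N, 1 ≤ N → MLBPF.IsRun M g c N P (ξ N) (ξh N))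
    (φ : X → ℝ) (hφ_meas : Measurable φ) (hφ_bdd : ∃ C : ℝ, ∀ x, |φ x| ≤ C) (n : ℕ) :
    ∀ᵐ ω ∂P, Tendsto
      (fun N => MLBPF.filterApprox g c N (fun q i => ξ N q i ω) (fun q i => ξh N q i ω) n φ)
      atTop (𝓝 (∫ x, φ x ∂(M.filter y n))) := by
  have hg_bdd' : ∀ n, ∃ C : ℝ, ∀ x, M.g x (y n) ≤ C := fun n => by
    obtain ⟨C, hC⟩ := hg_bdd n (Fin.last L)
    exact ⟨C, fun x => (hg_last n x).symm.le.trans ((le_abs_self _).trans (hC x))⟩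
  have hpred := MLBPF.HiddenMarkovModel.isFiniteMeasure_prediction hg_bdd'
  have hfilt := MLBPF.HiddenMarkovModel.isFiniteMeasure_unnormalizedFilter hg_bdd'
  have hres : MLBPF.ApproximatesOnLevels P (fun N i ω =>
      MLBPF.weightHat g c N (fun q j => ξ N q j ω) (fun q j => ξh N q j ω) n i)
      (fun N => ξh N n) (M.unnormalizedFilter y n) := by
    induction n with
    | zero =>
      exact MLBPF.ApproximatesOnLevels.resample hc hpos hg_meas hg_bdd hg_last hties hrun
        (MLBPF.approximatesOnLevels_init hc hrun)
    | succ n ih =>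
      exact MLBPF.ApproximatesOnLevels.resample hc hpos hg_meas hg_bdd hg_last hties hrun
        (ih.mutate hc hg_meas hrun)
  rw [M.integral_filter y n φ]
  exact hres.ae_tendsto_ratio hc (ENNReal.toReal_ne_zero.2
    ⟨M.unnormalizedFilter_univ_ne_zero hpos n, measure_ne_top _ _⟩) hφ_meas hφ_bdd
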